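/- Theorem (Telegrapher's impedance matrix). Let $n\ge 1$ and let $\mathbf L,\mathbf C,\mathbf R,\mathbf G\in\mathbb R^{n\times n}$ be symmetric with $\mathbf L,\mathbf C$ positive definite. Let $\|\cdot\|$ be the spectral norm, $\lambda_{\min},\lambda_{\max}$ the smallest and largest eigenvalue of a symmetric matrix, and for $a\in\mathbb R$ put $\mathbb C^+_a=\{s\in\mathbb C:\operatorname{Re}s>a\}$; let $\mathbb R^+=(0,\infty)$. Write $\sqrt A$ for the unique matrix $X$ with $X^2=A$ all of whose eigenvalues have positive real part, when exactly one such $X$ exists. Put $$\alpha=-\min\Big\{\tfrac{\lambda_{\min}(\mathbf G)}{\lambda_{\max}(\mathbf C)},\tfrac{\lambda_{\min}(\mathbf G)}{\lambda_{\min}(\mathbf C)},\tfrac{\lambda_{\min}(\mathbf R)}{\lambda_{\max}(\mathbf L)},\tfrac{\lambda_{\min}(\mathbf R)}{\lambda_{\min}(\mathbf L)}\Big\},$$ $$\kappa=\sup_{\omega\in\mathbb R}\left\|\exp\begin{bmatrix}0&i\omega\mathbf L\\ i\omega\mathbf C&0\end{bmatrix}\right\|,\qquad \theta=\frac{\max\{\|\mathbf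 R\|,\|\mathbf G\|\}}{\max\{\|\mathbf L\|,\|\mathbf C\|\}},\qquad \nu=\frac1{\kappa\max\{\|\mathbf L\|,\|\mathbf C\|\}},$$ and, for $s\in\mathbb C^+_\alpha$ and $d>0$, with $Q(s)=\sqrt{(\mathbf Cs+\mathbf G)(\mathbf Ls+\mathbf R)}$, $$B_d(s)=(\mathbf Ls+\mathbf R)\,Q(s)^{-1}\sinh(d\,Q(s)),\qquad D_d(s)=\cosh(d\,Q(s)),$$ $$Y(s,d)=\begin{bmatrix}D_d(s)B_d(s)^{-1}&-B_d(s)^{-1}\\-B_d(s)^{-1}&D_d(s)B_d(s)^{-1}\end{bmatrix}\quad\text{(the admittance matrix)}.$$ These objects are well defined: $\kappa<\infty$, and for all $s\in\mathbb C^+_\alpha$ and $d>0$ the square root $Q(s)$ exists and is unique, and $Q(s)$, $B_d(s)$ and $Y(s,d)$ are invertible. The impedance matrix $Z:\mathbb C^+_\alpha\times\mathbb R^+\to\mathbb C^{2n\times 2n}$, $Z(s,d)=Y(s,d)^{-1}$, has the following properties. 1. $Z$ is continuous. 2. For every $d\in\mathbb R^+$, the map $s\mapsto Z(s,d)$ is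 analytic on $\mathbb C^+_\alpha$. 3. For every $\beta\in[0,\infty)\cap(\alpha,\infty)$ and every $\delta>0$ there is $M>0$ such that $$\|Z(s,d)\|\le M\,e^{\frac{nd}{\nu}\operatorname{Re}(s+\theta)}\qquad\text{for all } s\in\mathbb C\text{ with }\operatorname{Re}s\ge\beta\text{ and all } d\ge\delta.$$ -/

import Mathlib

open scoped Matrix Matrix.Norms.L2Operator

/-- The open right half-plane `{s | Re s > a}`. -/
def rightHalfPlane (a : ℝ) : Set ℂ := {s | a < s.re}

/-- Smallest eigenvalue of a real matrix with real spectrum (used for symmetric matrices only). -/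
noncomputable def lambdaMin {n : ℕ} (A : Matrix (Fin n) (Fin n) ℝ) : ℝ := sInf (spectrum ℝ A)

/-- Largest eigenvalue of a real matrix with real spectrum (used for symmetric matrices only). -/
noncomputable def lambdaMax {n : ℕ} (A : Matrix (Fin n) (Fin n) ℝ) : ℝ := sSup (spectrum ℝ A)

/-- A real matrix regarded as a complex one. -/
noncomputable def toComplex {n : ℕ} (A : Matrix (Fin n) (Fin n) ℝ) : Matrix (Fin n) (Fin n) ℂ :=
  A.map Complex.ofReal

/-- `X` is a principal square root of `A`: its spectrum lies in the open right half-plane,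
and `X ^ 2 = A`. -/
def IsPrincipalSqrt {n : ℕ} (A X : Matrix (Fin n) (Fin n) ℂ) : Prop :=
  spectrum ℂ X ⊆ rightHalfPlane 0 ∧ X ^ 2 = A

open Classical in
/-- The principal square root of `A`, when exactly one exists (and `0` otherwise). -/
noncomputable def principalSqrt {n : ℕ} (A : Matrix (Fin n) (Fin n) ℂ) :
    Matrix (Fin n) (Fin n) ℂ :=
  if h : ∃! X, IsPrincipalSqrt A X then h.choose else 0

/-- Hyperbolic sine of a square matrix. -/
noncomputable def matrixSinh {n : ℕ} (X : Matrix (Fin n) (Fin n) ℂ) : Matrix (Fin n) (Fin n) ℂ :=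
  (2⁻¹ : ℂ) • (NormedSpace.exp X - NormedSpace.exp (-X))

/-- Hyperbolic cosine of a square matrix. -/
noncomputable def matrixCosh {n : ℕ} (X : Matrix (Fin n) (Fin n) ℂ) : Matrix (Fin n) (Fin n) ℂ :=
  (2⁻¹ : ℂ) • (NormedSpace.exp X + NormedSpace.exp (-X))

/-- The constant matrices of a uniform `n`-phase line, per unit length: inductance `L`,
capacitance `C`, resistance `R`, conductance `G`. -/
structure TransmissionLine (n : ℕ) where
  /-- inductance -/
  L : Matrix (Fin n) (Fin n) ℝ
  /-- capacitance -/
  C : Matrix (Fin n) (Fin n) ℝ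
  /-- resistance -/
  R : Matrix (Fin n) (Fin n) ℝ
  /-- conductance -/
  G : Matrix (Fin n) (Fin n) ℝ

namespace TransmissionLine

variable {n : ℕ} (ℓ : TransmissionLine n)

/-- The abscissa `α` of the half-plane on which the transfer matrices are considered. -/
noncomputable def alpha : ℝ :=
  -min (min (lambdaMin ℓ.G / lambdaMax ℓ.C) (lambdaMin ℓ.G / lambdaMin ℓ.C))
    (min (lambdaMin ℓ.R / lambdaMax ℓ.L) (lambdaMin ℓ.R / lambdaMin ℓ.L))

/-- Series impedance per unit length, `L s + R`. -/
noncomputable def series (s : ℂ) : Matrix (Fin n) (Fin n) ℂ := s • toComplex ℓ.L + toComplex ℓ.R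

/-- Shunt admittance per unit length, `C s + G`. -/
noncomputable def shunt (s : ℂ) : Matrix (Fin n) (Fin n) ℂ := s • toComplex ℓ.C + toComplex ℓ.G

/-- `√((C s + G)(L s + R))`. -/
noncomputable def root (s : ℂ) : Matrix (Fin n) (Fin n) ℂ :=
  principalSqrt (ℓ.shunt s * ℓ.series s)

/-- `(L s + R) √((C s + G)(L s + R))⁻¹`. -/
noncomputable def charImpedance (s : ℂ) : Matrix (Fin n) (Fin n) ℂ := ℓ.series s * (ℓ.root s)⁻¹

/-- The block `B_d(s)` of the ABCD matrix. -/
noncomputable def blockB (d : ℝ) (s : ℂ) : Matrix (Fin n) (Fin n) ℂ :=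
  ℓ.charImpedance s * matrixSinh ((d : ℂ) • ℓ.root s)

/-- The block `D_d(s)` of the ABCD matrix. -/
noncomputable def blockD (d : ℝ) (s : ℂ) : Matrix (Fin n) (Fin n) ℂ :=
  matrixCosh ((d : ℂ) • ℓ.root s)

/-- The admittance matrix `Y(s,d)`. -/
noncomputable def admittance (s : ℂ) (d : ℝ) : Matrix (Fin n ⊕ Fin n) (Fin n ⊕ Fin n) ℂ :=
  Matrix.fromBlocks
    (ℓ.blockD d s * (ℓ.blockB d s)⁻¹) (-(ℓ.blockB d s)⁻¹)
    (-(ℓ.blockB d s)⁻¹) (ℓ.blockD d s * (ℓ.blockB d s)⁻¹)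

/-- The impedance matrix `Z(s,d) = Y(s,d)⁻¹`. -/
noncomputable def impedance (s : ℂ) (d : ℝ) : Matrix (Fin n ⊕ Fin n) (Fin n ⊕ Fin n) ℂ :=
  (ℓ.admittance s d)⁻¹

/-- Spectral norm of `exp [[0, iωL], [iωC, 0]]`. -/
noncomputable def losslessNorm (ω : ℝ) : ℝ :=
  ‖NormedSpace.exp (Matrix.fromBlocks 0 ((Complex.I * ω) • toComplex ℓ.L)
    ((Complex.I * ω) • toComplex ℓ.C) 0)‖

/-- `κ`, the supremum of `losslessNorm` over all real frequencies. -/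
noncomputable def kappa : ℝ := sSup (Set.range ℓ.losslessNorm)

/-- `θ = max(‖R‖, ‖G‖) / max(‖L‖, ‖C‖)`. -/
noncomputable def theta : ℝ :=
  max ‖toComplex ℓ.R‖ ‖toComplex ℓ.G‖ / max ‖toComplex ℓ.L‖ ‖toComplex ℓ.C‖

/-- `ν = 1 / (κ max(‖L‖, ‖C‖))`. -/
noncomputable def nu : ℝ := 1 / (ℓ.kappa * max ‖toComplex ℓ.L‖ ‖toComplex ℓ.C‖)

end TransmissionLine

/-! The chain matrix exp(d · `generator s`) carries (V(0), J(0)) to (V(d), J(d)) along V' = PJ, J' =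
SV, where P = Ls + R and S = Cs + G. Let Γ and D be its lower blocks, so J(d) = ΓV(0) + DJ(0). By
`exp_fromBlocks_antidiagonal`, Γ = sinh(dQ)Q⁻¹S and D = cosh(dQ); hence ΓB = sinh²(dQ), and
`admittance_mul_impedance` gives Z = [[Γ⁻¹D, Γ⁻¹], [Γ⁻¹, Γ⁻¹D]]. The square root has disappeared:
once Γ is invertible, Z is an analytic function of a matrix that is entire in s and continuous in
(s, d).

Invertibility of Γ and the growth bound both rest on `exists_norm_fstBlock_le`. For Re s ≥ β > α, P
and S are coercive, so the power flow Re⟨V, J⟩ grows at rate at least c(‖V‖² + ‖J‖²). The energy ⟨V,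
L⁻¹V⟩ + ⟨J, C⁻¹J⟩ is comparable to ‖V‖² + ‖J‖², and its rate of change involves s only through Re s.
A small weighted multiple of the energy can therefore be added to the power flow without spoiling
monotonicity, and Cauchy–Schwarz yields ‖V(0)‖ ≤ K(‖J(0)‖ + ‖J(d)‖) with K affine in |Re s| and free
of Im s. This makes Γ injective and bounds Γ⁻¹ and Γ⁻¹D by K; for Re s ≥ 0 an affine bound is
dominated by the exponential.

Coercivity also keeps the spectrum of SP off (-∞, 0], which gives Q. -/

/-! ### Principal square roots of complex matrices -/

open Polynomial in
theorem dvd_pow_card_roots_of_forall_isRoot {f g : ℂ[X]} (hf : f.Monic)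
    (h : ∀ a, f.IsRoot a → g.IsRoot a) : f ∣ g ^ f.roots.card := by
  have hs := (IsAlgClosed.splits f).eq_prod_roots_of_monic hf
  conv_lhs => rw [hs]
  rw [← Multiset.prod_replicate, ← Multiset.map_const']
  refine Multiset.prod_dvd_prod_of_dvd _ _ fun a ha => ?_
  exact dvd_iff_isRoot.2 (h a (isRoot_of_mem_roots ha))

-- Interpolating the principal root at the zeros of f solves p² = X modulo the nilradical of
-- ℂ[X]/(f). Newton iteration lifts this to an exact solution, because the derivative 2q is a unit
-- modulo f, and the lift keeps the values at the zeros.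
open Polynomial in
theorem exists_sq_eq_mod {f : ℂ[X]} (hf : f.Monic) (h : ∀ a, f.IsRoot a → a ∈ Complex.slitPlane) :
    ∃ p : ℂ[X], f ∣ p ^ 2 - X ∧ ∀ a, f.IsRoot a → 0 < (p.eval a).re := by
  classical
  set q : ℂ[X] := Lagrange.interpolate f.roots.toFinset id (fun a : ℂ => a ^ (2⁻¹ : ℂ)) with hq
  have hqe : ∀ a, f.IsRoot a → q.eval a = a ^ (2⁻¹ : ℂ) := by
    intro a ha
    have := Lagrange.eval_interpolate_at_node (s := f.roots.toFinset) (v := id) (i := a)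
      (fun a : ℂ => a ^ (2⁻¹ : ℂ)) (Function.injective_id.injOn) (by simp [hf.ne_zero]; exact ha)
    exact this
  have hre : ∀ a : ℂ, a ∈ Complex.slitPlane → 0 < (a ^ (2⁻¹ : ℂ)).re := by
    intro a ha
    have h0 := Complex.slitPlane_ne_zero ha
    have harg := Complex.mem_slitPlane_iff_arg.1 ha
    rw [Complex.cpow_def_of_ne_zero h0, Complex.exp_re]
    refine mul_pos (Real.exp_pos _) (Real.cos_pos_of_mem_Ioo ?_)
    have : (Complex.log a * 2⁻¹).im = a.arg / 2 := by
      have : (2⁻¹ : ℂ) = ((2⁻¹ : ℝ) : ℂ) := by push_cast; rfl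
      rw [this, Complex.im_mul_ofReal, Complex.log_im]; ring
    rw [this]
    have h1 := Complex.neg_pi_lt_arg a
    have h2 := lt_of_le_of_ne (Complex.arg_le_pi a) harg.1
    constructor <;> linarith
  have hnil : IsNilpotent (aeval (AdjoinRoot.mk f q) (X ^ 2 - C (AdjoinRoot.root f))) := by
    refine ⟨f.roots.card, ?_⟩
    have : aeval (AdjoinRoot.mk f q) (X ^ 2 - C (AdjoinRoot.root f)) =
        AdjoinRoot.mk f (q ^ 2 - X) := by simp
    rw [this, ← map_pow, AdjoinRoot.mk_eq_zero]
    refine dvd_pow_card_roots_of_forall_isRoot hf fun a ha => ?_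
    rw [IsRoot, eval_sub, eval_pow, hqe a ha, eval_X]
    have := Complex.cpow_nat_inv_pow a (n := 2) two_ne_zero
    simp only [Nat.cast_ofNat] at this
    rw [this, sub_self]
  have hu : IsUnit (aeval (AdjoinRoot.mk f q)
      (derivative (X ^ 2 - C (AdjoinRoot.root f)))) := by
    have : aeval (AdjoinRoot.mk f q) (derivative (X ^ 2 - C (AdjoinRoot.root f))) =
        AdjoinRoot.mk f (2 * q) := by simp [one_add_one_eq_two, map_ofNat]
    rw [this]
    have hc : IsCoprime (2 * q) f := by
      rw [isCoprime_iff_aeval_ne_zero_of_isAlgClosed (K := ℂ) (k := ℂ)]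
      intro a
      by_cases ha : f.IsRoot a
      · left
        have := hre a (h a ha)
        rw [← hqe a ha] at this
        have h0 : q.eval a ≠ 0 := fun h0 => by simp [h0] at this
        simpa using h0
      · right; simpa using ha
    obtain ⟨u, v, huv⟩ := hc
    refine IsUnit.of_mul_eq_one_right (AdjoinRoot.mk f u) ?_
    have := congrArg (AdjoinRoot.mk f) huv
    simpa using this
  obtain ⟨r, ⟨hr1, hr2⟩, -⟩ := existsUnique_nilpotent_sub_and_aeval_eq_zero hnil hu
  obtain ⟨p, rfl⟩ := AdjoinRoot.mk_surjective r
  refine ⟨p, ?_, fun a ha => ?_⟩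
  · rw [← AdjoinRoot.mk_eq_zero]
    simpa using hr2
  -- The correction is nilpotent modulo f, hence vanishes at every zero of f, so p and q agree
  -- there.
  · obtain ⟨k, hk⟩ := hr1
    rw [← map_sub, ← map_pow, AdjoinRoot.mk_eq_zero] at hk
    have := ha.dvd hk
    rw [IsRoot, eval_pow, eval_sub] at this
    have := eq_zero_of_pow_eq_zero this
    rw [← sub_eq_zero.1 this, hqe a ha]
    exact hre a (h a ha)

theorem exists_isPrincipalSqrt {n : ℕ} (A : Matrix (Fin n) (Fin n) ℂ)
    (h : spectrum ℂ A ⊆ Complex.slitPlane) : ∃ X, IsPrincipalSqrt A X := by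
  obtain ⟨p, ⟨g, hg⟩, hp⟩ := exists_sq_eq_mod A.charpoly_monic
    (fun a ha => h (Matrix.mem_spectrum_iff_isRoot_charpoly.2 ha))
  refine ⟨Polynomial.aeval A p, ?_, ?_⟩
  · intro μ hμ
    cases isEmpty_or_nonempty (Fin n)
    · rw [spectrum.of_subsingleton] at hμ; exact hμ.elim
    rw [spectrum.map_polynomial_aeval] at hμ
    obtain ⟨a, ha, rfl⟩ := hμ
    exact hp a (Matrix.mem_spectrum_iff_isRoot_charpoly.1 ha)
  · have := congrArg (Polynomial.aeval A) hg
    simpa [Matrix.aeval_self_charpoly, sub_eq_zero] using this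

/-- Sylvester's argument: p(X)W = Wp(Y) for every polynomial p, and for p the characteristic
polynomial of Y the right side vanishes while p(X) is invertible. -/
theorem eq_zero_of_mul_eq_mul {n : ℕ} {X Y W : Matrix (Fin n) (Fin n) ℂ}
    (hd : Disjoint (spectrum ℂ X) (spectrum ℂ Y)) (h : X * W = W * Y) : W = 0 := by
  have hp : ∀ p : Polynomial ℂ, Polynomial.aeval X p * W = W * Polynomial.aeval Y p := by
    intro p
    induction p using Polynomial.induction_on' with
    | add p q hp hq => simp [add_mul, mul_add, hp, hq]
    | monomial k a =>
      have : X ^ k * W = W * Y ^ k := by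
        induction k with
        | zero => simp
        | succ k ih => rw [pow_succ, mul_assoc, h, ← mul_assoc, ih, mul_assoc, ← pow_succ]
      simp [Polynomial.aeval_monomial, Algebra.algebraMap_eq_smul_one, this]
  have h0 := hp Y.charpoly
  rw [Matrix.aeval_self_charpoly, mul_zero] at h0
  have hu : IsUnit (Polynomial.aeval X Y.charpoly) := by
    cases isEmpty_or_nonempty (Fin n)
    · exact isUnit_of_subsingleton _
    rw [← spectrum.zero_notMem_iff ℂ, spectrum.map_polynomial_aeval]
    rintro ⟨a, ha, ha'⟩
    exact Set.disjoint_left.1 hd ha (Matrix.mem_spectrum_iff_isRoot_charpoly.2 ha')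
  exact hu.mul_right_eq_zero.1 h0

theorem IsPrincipalSqrt.unique {n : ℕ} {A X Y : Matrix (Fin n) (Fin n) ℂ}
    (hX : IsPrincipalSqrt A X) (hY : IsPrincipalSqrt A Y) : X = Y := by
  have h : X * (X - Y) = (X - Y) * (-Y) := by
    have := hX.2.trans hY.2.symm
    rw [mul_sub, sub_mul, mul_neg, mul_neg, ← sq, ← sq, this]; abel
  refine sub_eq_zero.1 (eq_zero_of_mul_eq_mul ?_ h)
  rw [Set.disjoint_left]
  intro μ h1 h2
  rw [← spectrum.neg_eq, Set.mem_neg] at h2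
  have h1 : 0 < μ.re := hX.1 h1
  have h2 : 0 < (-μ).re := hY.1 h2
  rw [Complex.neg_re] at h2
  linarith

theorem existsUnique_isPrincipalSqrt {n : ℕ} (A : Matrix (Fin n) (Fin n) ℂ)
    (h : spectrum ℂ A ⊆ Complex.slitPlane) : ∃! X, IsPrincipalSqrt A X := by
  obtain ⟨X, hX⟩ := exists_isPrincipalSqrt A h
  exact ⟨X, hX, fun Y hY => hY.unique hX⟩

theorem isPrincipalSqrt_principalSqrt {n : ℕ} {A : Matrix (Fin n) (Fin n) ℂ}
    (h : ∃! X, IsPrincipalSqrt A X) : IsPrincipalSqrt A (principalSqrt A) := by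
  rw [principalSqrt, dif_pos h]
  exact h.choose_spec.1

theorem IsPrincipalSqrt.isUnit {n : ℕ} {A X : Matrix (Fin n) (Fin n) ℂ}
    (hX : IsPrincipalSqrt A X) : IsUnit X := by
  rw [← spectrum.zero_notMem_iff ℂ]
  intro h
  exact lt_irrefl (0 : ℝ) (hX.1 h)

/-! ### The chain matrix in terms of hyperbolic functions -/

section ExpBlocks

variable {n : ℕ}

theorem exp_fromBlocks_diagonal (A B : Matrix (Fin n) (Fin n) ℂ) :
    NormedSpace.exp (Matrix.fromBlocks A 0 0 B) =
      Matrix.fromBlocks (NormedSpace.exp A) 0 0 (NormedSpace.exp B) := by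
  let T : Matrix (Fin n) (Fin n) ℂ × Matrix (Fin n) (Fin n) ℂ →+
      Matrix (Fin n ⊕ Fin n) (Fin n ⊕ Fin n) ℂ :=
    { toFun := fun X => Matrix.fromBlocks X.1 0 0 X.2
      map_zero' := by simp
      map_add' := fun X Y => by simp [Matrix.fromBlocks_add] }
  have hT : Continuous T :=
    continuous_fst.matrix_fromBlocks continuous_const continuous_const continuous_snd
  have h := ((NormedSpace.exp_series_hasSum_exp' (𝕂 := ℂ) A).prodMk
    (NormedSpace.exp_series_hasSum_exp' (𝕂 := ℂ) B)).map T hT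
  refine (NormedSpace.exp_series_hasSum_exp' (𝕂 := ℂ) (Matrix.fromBlocks A 0 0 B)).unique ?_
  refine h.congr_fun fun k => ?_
  have : Matrix.fromBlocks A 0 0 B ^ k = Matrix.fromBlocks (A ^ k) 0 0 (B ^ k) := by
    induction k with
    | zero => simp
    | succ k ih => simp [pow_succ, ih, Matrix.fromBlocks_multiply]
  simp [T, this, Matrix.fromBlocks_smul]

/-- With X = Q⁻¹S, the rows [X, 1] and [-X, 1] diagonalise the generator from the left, with
eigenblocks Q and -Q. Adding the resulting two block rows isolates the lower blocks of the
exponential. -/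
theorem exp_fromBlocks_antidiagonal {P S Q : Matrix (Fin n) (Fin n) ℂ} (hQ : IsUnit Q)
    (h : Q ^ 2 = S * P) (d : ℂ) :
    (NormedSpace.exp (d • Matrix.fromBlocks 0 P S 0)).toBlocks₂₁ =
      matrixSinh (d • Q) * Q⁻¹ * S ∧
    (NormedSpace.exp (d • Matrix.fromBlocks 0 P S 0)).toBlocks₂₂ = matrixCosh (d • Q) := by
  have hdet := (Matrix.isUnit_iff_isUnit_det _).1 hQ
  set X := Q⁻¹ * S with hX
  have hXP : X * P = Q := by
    rw [hX, mul_assoc, ← h, sq, Matrix.nonsing_inv_mul_cancel_left _ _ hdet]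
  have hQX : Q * X = S := Matrix.mul_nonsing_inv_cancel_left _ _ hdet
  have hU : SemiconjBy (Matrix.fromBlocks X 1 (-X) 1) (d • Matrix.fromBlocks 0 P S 0)
      (Matrix.fromBlocks (d • Q) 0 0 (-(d • Q))) := by
    rw [SemiconjBy, Matrix.fromBlocks_smul, Matrix.fromBlocks_multiply, Matrix.fromBlocks_multiply]
    simp [hXP, hQX]
  -- The intertwining passes to the exponential term by term, so no inverse of the intertwiner is
  -- needed.
  have hexp : Matrix.fromBlocks X 1 (-X) 1 * NormedSpace.exp (d • Matrix.fromBlocks 0 P S 0) =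
      NormedSpace.exp (Matrix.fromBlocks (d • Q) 0 0 (-(d • Q))) * Matrix.fromBlocks X 1 (-X) 1 := by
    have h1 := (NormedSpace.exp_series_hasSum_exp' (𝕂 := ℂ)
      (d • Matrix.fromBlocks 0 P S 0)).mul_left (Matrix.fromBlocks X 1 (-X) 1)
    have h2 := (NormedSpace.exp_series_hasSum_exp' (𝕂 := ℂ)
      (Matrix.fromBlocks (d • Q) 0 0 (-(d • Q)))).mul_right (Matrix.fromBlocks X 1 (-X) 1)
    refine h1.unique (h2.congr_fun fun k => ?_)
    rw [mul_smul_comm, smul_mul_assoc, (hU.pow_right k).eq]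
  rw [exp_fromBlocks_diagonal,
    ← Matrix.fromBlocks_toBlocks (NormedSpace.exp (d • Matrix.fromBlocks 0 P S 0)),
    Matrix.fromBlocks_multiply, Matrix.fromBlocks_multiply, Matrix.fromBlocks_inj] at hexp
  simp only [one_mul, mul_one, neg_mul, mul_neg, zero_mul, add_zero, zero_add, neg_zero] at hexp
  obtain ⟨a1, b1, a2, b2⟩ := hexp
  have half : ∀ X : Matrix (Fin n) (Fin n) ℂ, X = (2⁻¹ : ℂ) • (X + X) := by
    intro X; rw [← two_smul ℂ X, smul_smul]; simp
  constructor
  · rw [half (Matrix.toBlocks₂₁ _), matrixSinh, mul_assoc, ← hX, smul_mul_assoc, sub_mul, ← a1,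
      sub_eq_add_neg, ← a2]
    congr 1; abel
  · rw [half (Matrix.toBlocks₂₂ _), matrixCosh, ← b1, ← b2]
    congr 1; abel

theorem matrixCosh_mul_self_sub_one (X : Matrix (Fin n) (Fin n) ℂ) :
    matrixCosh X * matrixCosh X - 1 = matrixSinh X * matrixSinh X := by
  have h1 : NormedSpace.exp X * NormedSpace.exp (-X) = 1 := by
    rw [← Matrix.exp_add_of_commute _ _ (Commute.refl X).neg_right, add_neg_cancel,
      NormedSpace.exp_zero]
  have h2 : NormedSpace.exp (-X) * NormedSpace.exp X = 1 := by
    rw [← Matrix.exp_add_of_commute _ _ (Commute.refl X).neg_left, neg_add_cancel,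
      NormedSpace.exp_zero]
  simp only [matrixCosh, matrixSinh, smul_mul_smul_comm, add_mul, mul_add, sub_mul, mul_sub, h1, h2]
  match_scalars <;> norm_num

theorem commute_matrixCosh_matrixSinh (X : Matrix (Fin n) (Fin n) ℂ) :
    Commute (matrixCosh X) (matrixSinh X) := by
  have h : Commute (NormedSpace.exp X) (NormedSpace.exp (-X)) :=
    ((Commute.refl X).neg_right).exp
  refine Commute.smul_left (Commute.smul_right ?_ _) _
  exact ((Commute.refl _).add_left h.symm).sub_right (h.add_left (Commute.refl _))

end ExpBlocks

/-! ### Power flow and energy estimates -/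

section Energy

variable {H : Type*} [NormedAddCommGroup H] [InnerProductSpace ℂ H] {V J : ℝ → H}

local notation "re⟪" x ", " y "⟫" => Complex.re (inner ℂ x y)

theorem abs_re_inner_le (x y : H) : |re⟪x, y⟫| ≤ ‖x‖ * ‖y‖ :=
  (Complex.abs_re_le_norm _).trans (norm_inner_le_norm _ _)

theorem le_of_mul_sq_add_sq_le {m a b p q : ℝ} (hm : 0 < m) (ha : 0 ≤ a) (hp : 0 ≤ p)
    (hq : 0 ≤ q) (h : m * (a ^ 2 + b ^ 2) ≤ 2 * (b * q + a * p)) : a ≤ 2 / m * (p + q) := by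
  have hM : m * max a b ^ 2 ≤ 2 * max a b * (p + q) := by
    have h1 : max a b ^ 2 ≤ a ^ 2 + b ^ 2 := by
      rcases max_choice a b with h | h <;> rw [h] <;> nlinarith
    have h2 : b * q ≤ max a b * q := by gcongr; exact le_max_right _ _
    have h3 : a * p ≤ max a b * p := by gcongr; exact le_max_left _ _
    nlinarith
  have h0 : 0 ≤ max a b := ha.trans (le_max_left _ _)
  rcases h0.eq_or_lt with h0 | h0
  · exact ((le_max_left a b).trans_eq h0.symm).trans (by positivity)
  · refine (le_max_left a b).trans ?_
    rw [div_mul_eq_mul_div, le_div_iff₀ hm]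
    have : max a b * (max a b * m) ≤ max a b * (2 * (p + q)) := by nlinarith
    exact le_of_mul_le_mul_left this h0

/-- Adding the two end estimates and dropping the J terms leaves a quadratic in the V norms bounded,
through Cauchy–Schwarz, by an expression linear in them. -/
theorem norm_le_of_powerFlow {m d : ℝ} (hm : 0 < m)
    (h₀ : m * (‖V 0‖ ^ 2 + ‖J 0‖ ^ 2) ≤ re⟪V d, J d⟫ - re⟪V 0, J 0⟫)
    (h₁ : m * (‖V d‖ ^ 2 + ‖J d‖ ^ 2) ≤ re⟪V d, J d⟫ - re⟪V 0, J 0⟫) :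
    ‖V 0‖ ≤ 2 / m * (‖J 0‖ + ‖J d‖) := by
  refine le_of_mul_sq_add_sq_le (b := ‖V d‖) hm (norm_nonneg _) (norm_nonneg _) (norm_nonneg _) ?_
  have h2 := le_of_abs_le (abs_re_inner_le (V d) (J d))
  have h3 := neg_le_of_abs_le (abs_re_inner_le (V 0) (J 0))
  have h4 : 0 ≤ m * ‖J 0‖ ^ 2 := by positivity
  have h5 : 0 ≤ m * ‖J d‖ ^ 2 := by positivity
  linarith

theorem abs_energy_deriv_le (F T : H →L[ℂ] H) (σ : ℝ) (v j : H) :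
    |4 * σ * re⟪v, j⟫ + 2 * re⟪v, F j⟫ + 2 * re⟪j, T v⟫| ≤
      (2 * |σ| + ‖F‖ + ‖T‖) * (‖v‖ ^ 2 + ‖j‖ ^ 2) := by
  have h1 := abs_re_inner_le v j
  have h2 : |re⟪v, F j⟫| ≤ ‖F‖ * (‖v‖ * ‖j‖) :=
    (abs_re_inner_le v (F j)).trans
      ((mul_le_mul_of_nonneg_left (F.le_opNorm j) (norm_nonneg v)).trans_eq (by ring))
  have h3 : |re⟪j, T v⟫| ≤ ‖T‖ * (‖v‖ * ‖j‖) :=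
    (abs_re_inner_le j (T v)).trans
      ((mul_le_mul_of_nonneg_left (T.le_opNorm v) (norm_nonneg j)).trans_eq (by ring))
  have h4 : 2 * (‖v‖ * ‖j‖) ≤ ‖v‖ ^ 2 + ‖j‖ ^ 2 := by
    have := two_mul_le_add_sq ‖v‖ ‖j‖; linarith
  calc _ ≤ |4 * σ * re⟪v, j⟫| + |2 * re⟪v, F j⟫| + |2 * re⟪j, T v⟫| := abs_add_three _ _ _
    _ ≤ 4 * |σ| * (‖v‖ * ‖j‖) + 2 * (‖F‖ * (‖v‖ * ‖j‖)) + 2 * (‖T‖ * (‖v‖ * ‖j‖)) := by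
        simp only [abs_mul, Nat.abs_ofNat]
        gcongr
    _ = (2 * |σ| + ‖F‖ + ‖T‖) * (2 * (‖v‖ * ‖j‖)) := by ring
    _ ≤ _ := by gcongr

variable [NormedSpace ℝ H]

theorem HasDerivAt.re_inner {V' J' : H} {x : ℝ} (hV : HasDerivAt V V' x)
    (hJ : HasDerivAt J J' x) :
    HasDerivAt (fun t => re⟪V t, J t⟫) (re⟪V x, J'⟫ + re⟪V', J x⟫) x := by
  refine (Complex.reCLM.hasFDerivAt.comp_hasDerivAt x (hV.inner ℂ hJ)).congr_deriv ?_
  simp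

/-- A solution of `V' = P J`, `J' = S V` on an interval of length `d`, with `P` and `S` coercive,
is controlled at both ends by the difference of the boundary values of the power flow. -/
theorem norm_sq_le_powerFlow {P S : H →L[ℂ] H} (hV : ∀ x, HasDerivAt V (P (J x)) x)
    (hJ : ∀ x, HasDerivAt J (S (V x)) x) {c : ℝ} (hc : 0 < c)
    (hP : ∀ x, c * ‖x‖ ^ 2 ≤ re⟪x, P x⟫) (hS : ∀ x, c * ‖x‖ ^ 2 ≤ re⟪x, S x⟫)
    {E E' : ℝ → ℝ} (hE : ∀ x, HasDerivAt E (E' x) x) {K e₁ e₂ : ℝ} (he₂ : 0 < e₂) (hK : 0 ≤ K)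
    (hE' : ∀ x, |E' x| ≤ K * (‖V x‖ ^ 2 + ‖J x‖ ^ 2))
    (hE₁ : ∀ x, e₁ * (‖V x‖ ^ 2 + ‖J x‖ ^ 2) ≤ E x)
    (hE₂ : ∀ x, E x ≤ e₂ * (‖V x‖ ^ 2 + ‖J x‖ ^ 2)) (he₁ : 0 < e₁) {d : ℝ} (hd : 0 < d) :
    c * e₁ / (e₂ / d + K) * (‖V 0‖ ^ 2 + ‖J 0‖ ^ 2) ≤ re⟪V d, J d⟫ - re⟪V 0, J 0⟫ ∧
    c * e₁ / (e₂ / d + K) * (‖V d‖ ^ 2 + ‖J d‖ ^ 2) ≤ re⟪V d, J d⟫ - re⟪V 0, J 0⟫ := by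
  -- The largest k for which c still absorbs k times the derivative of weight × energy: the slope
  -- 1/d of the weight contributes e₂/d, the energy derivative contributes K.
  set k := c / (e₂ / d + K) with hk
  have hk0 : 0 < e₂ / d + K := by positivity
  have hkp : 0 < k := by positivity
  have hf : ∀ x, HasDerivAt (fun t => re⟪V t, J t⟫) (re⟪V x, S (V x)⟫ + re⟪P (J x), J x⟫) x :=
    fun x => (hV x).re_inner (hJ x)
  have hf' : ∀ x, c * (‖V x‖ ^ 2 + ‖J x‖ ^ 2) ≤ re⟪V x, S (V x)⟫ + re⟪P (J x), J x⟫ := by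
    intro x
    have h1 := hS (V x)
    have h2 := hP (J x)
    have h3 : re⟪P (J x), J x⟫ = re⟪J x, P (J x)⟫ := inner_re_symm (𝕜 := ℂ) _ _
    rw [h3]; linarith
  -- Here t is the value of the weight at x and r its slope.
  have key : ∀ x ∈ Set.Icc 0 d, ∀ t : ℝ, |t| ≤ 1 → ∀ r : ℝ, |r| ≤ 1 / d →
      0 ≤ (re⟪V x, S (V x)⟫ + re⟪P (J x), J x⟫) + k * (r * E x + t * E' x) := by
    intro x _ t ht r hr
    set N := ‖V x‖ ^ 2 + ‖J x‖ ^ 2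
    have hN : 0 ≤ N := by positivity
    have hE0 : 0 ≤ E x := le_trans (by positivity) (hE₁ x)
    have h1 : |r * E x + t * E' x| ≤ (e₂ / d + K) * N := by
      calc |r * E x + t * E' x| ≤ |r| * |E x| + |t| * |E' x| := by
            rw [← abs_mul, ← abs_mul]; exact abs_add_le _ _
        _ ≤ 1 / d * (e₂ * N) + 1 * (K * N) := by
            gcongr
            · rw [abs_of_nonneg hE0]; exact hE₂ x
            · exact hE' x
        _ = (e₂ / d + K) * N := by ring
    have h2 : k * ((e₂ / d + K) * N) = c * N := by rw [hk]; field_simp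
    have h3 := mul_le_mul_of_nonneg_left (neg_le_of_abs_le h1) hkp.le
    have h4 := hf' x
    nlinarith
  have hkc : c * e₁ / (e₂ / d + K) = k * e₁ := by rw [hk]; ring
  rw [hkc]
  constructor
  -- The weight 1 - t/d vanishes at d, so monotonicity leaves only k·E(0) next to the power
  -- difference. The weight -t/d below does the same for E(d).
  · have hg : ∀ x, HasDerivAt (fun t => re⟪V t, J t⟫ + k * ((1 - t / d) * E t))
        ((re⟪V x, S (V x)⟫ + re⟪P (J x), J x⟫) + k * (-(1 / d) * E x + (1 - x / d) * E' x)) x := by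
      intro x
      exact (hf x).add
        (((((hasDerivAt_id x).div_const d).const_sub 1).mul (hE x)).const_mul k)
    have hm : MonotoneOn (fun t => re⟪V t, J t⟫ + k * ((1 - t / d) * E t)) (Set.Icc 0 d) := by
      refine monotoneOn_of_deriv_nonneg (convex_Icc 0 d)
        (fun x _ => (hg x).continuousAt.continuousWithinAt)
        (fun x _ => (hg x).differentiableAt.differentiableWithinAt) fun x hx => ?_
      have hx := interior_subset hx
      rw [(hg x).deriv]
      refine key x hx _ ?_ _ (by rw [abs_neg, abs_of_pos (by positivity)])
      have h1 : x / d ≤ 1 := (div_le_one hd).2 hx.2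
      have h0 : 0 ≤ x / d := div_nonneg hx.1 hd.le
      rw [abs_le]; constructor <;> linarith
    have := hm (Set.left_mem_Icc.2 hd.le) (Set.right_mem_Icc.2 hd.le) hd.le
    simp only [zero_div, sub_zero, one_mul, div_self hd.ne', sub_self, zero_mul, mul_zero,
      add_zero] at this
    have h1 := mul_le_mul_of_nonneg_left (hE₁ 0) hkp.le
    linarith
  · have hg : ∀ x, HasDerivAt (fun t => re⟪V t, J t⟫ + k * ((-(t / d)) * E t))
        ((re⟪V x, S (V x)⟫ + re⟪P (J x), J x⟫) + k * (-(1 / d) * E x + (-(x / d)) * E' x)) x := by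
      intro x
      exact (hf x).add (((((hasDerivAt_id x).div_const d).neg).mul (hE x)).const_mul k)
    have hm : MonotoneOn (fun t => re⟪V t, J t⟫ + k * ((-(t / d)) * E t)) (Set.Icc 0 d) := by
      refine monotoneOn_of_deriv_nonneg (convex_Icc 0 d)
        (fun x _ => (hg x).continuousAt.continuousWithinAt)
        (fun x _ => (hg x).differentiableAt.differentiableWithinAt) fun x hx => ?_
      have hx := interior_subset hx
      rw [(hg x).deriv]
      refine key x hx _ ?_ _ (by rw [abs_neg, abs_of_pos (by positivity)])
      have h1 : x / d ≤ 1 := (div_le_one hd).2 hx.2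
      have h0 : 0 ≤ x / d := div_nonneg hx.1 hd.le
      rw [abs_le]; constructor <;> linarith
    have := hm (Set.left_mem_Icc.2 hd.le) (Set.right_mem_Icc.2 hd.le) hd.le
    simp only [zero_div, neg_zero, div_self hd.ne', zero_mul, mul_zero, add_zero] at this
    have h1 := mul_le_mul_of_nonneg_left (hE₁ d) hkp.le
    linarith

/-- The derivative of the energy `⟪V, L⁻¹ V⟫ + ⟪J, C⁻¹ J⟫` along `V' = (L s + R) J`,
`J' = (C s + G) V` involves only the real part of `s`. -/
theorem hasDerivAt_energy [IsScalarTower ℝ ℂ H] {P S A B F T : H →L[ℂ] H} {s : ℂ}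
    (hV : ∀ x, HasDerivAt V (P (J x)) x) (hJ : ∀ x, HasDerivAt J (S (V x)) x)
    (hA : ∀ x y, inner ℂ (A x) y = inner ℂ x (A y)) (hB : ∀ x y, inner ℂ (B x) y = inner ℂ x (B y))
    (hAP : ∀ x, A (P x) = s • x + F x) (hBS : ∀ x, B (S x) = s • x + T x) (x : ℝ) :
    HasDerivAt (fun t => re⟪V t, A (V t)⟫ + re⟪J t, B (J t)⟫)
      (4 * s.re * re⟪V x, J x⟫ + 2 * re⟪V x, F (J x)⟫ + 2 * re⟪J x, T (V x)⟫) x := by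
  have hAV : HasDerivAt (fun t => A (V t)) (A (P (J x))) x :=
    (A.restrictScalars ℝ).hasFDerivAt.comp_hasDerivAt x (hV x)
  have hBJ : HasDerivAt (fun t => B (J t)) (B (S (V x))) x :=
    (B.restrictScalars ℝ).hasFDerivAt.comp_hasDerivAt x (hJ x)
  have h := ((hV x).re_inner hAV).add ((hJ x).re_inner hBJ)
  refine h.congr_deriv ?_
  have h1 : re⟪P (J x), A (V x)⟫ = re⟪V x, A (P (J x))⟫ := by
    rw [← hA]; exact inner_re_symm (𝕜 := ℂ) _ _
  have h2 : re⟪S (V x), B (J x)⟫ = re⟪J x, B (S (V x))⟫ := by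
    rw [← hB]; exact inner_re_symm (𝕜 := ℂ) _ _
  -- The terms s⟨V, J⟩ and s⟨J, V⟩ involve conjugate inner products, so the contributions of Im s
  -- cancel in the real part.
  have h3 : inner ℂ (J x) (V x) = (starRingEnd ℂ) (inner ℂ (V x) (J x)) := (inner_conj_symm _ _).symm
  rw [h1, h2, hAP, hBS, inner_add_right, inner_add_right, inner_smul_right, inner_smul_right, h3]
  simp only [Complex.add_re, Complex.mul_re, Complex.conj_re, Complex.conj_im]
  ring

end Energy

/-! ### Rayleigh quotients and coercivity -/

section Rayleigh

variable {n : ℕ}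

theorem toComplex_mul (A B : Matrix (Fin n) (Fin n) ℝ) :
    toComplex (A * B) = toComplex A * toComplex B :=
  Matrix.map_mul (f := Complex.ofRealHom)

theorem toComplex_one : toComplex (1 : Matrix (Fin n) (Fin n) ℝ) = 1 :=
  Matrix.map_one _ Complex.ofReal_zero Complex.ofReal_one

theorem toComplex_isHermitian {A : Matrix (Fin n) (Fin n) ℝ} (hA : A.IsSymm) :
    (toComplex A).IsHermitian := by
  ext i j
  simp [toComplex, hA.apply i j]

theorem re_inner_toComplex (A : Matrix (Fin n) (Fin n) ℝ) (x : EuclideanSpace ℂ (Fin n)) :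
    (inner ℂ x (Matrix.toEuclideanCLM (n := Fin n) (𝕜 := ℂ) (toComplex A) x)).re =
      (fun i => (x i).re) ⬝ᵥ A *ᵥ (fun i => (x i).re) +
      (fun i => (x i).im) ⬝ᵥ A *ᵥ (fun i => (x i).im) := by
  simp only [PiLp.inner_apply, Complex.re_sum, dotProduct, ← Finset.sum_add_distrib]
  refine Finset.sum_congr rfl fun i _ => ?_
  have : (Matrix.toEuclideanCLM (n := Fin n) (𝕜 := ℂ) (toComplex A) x) i =
      ∑ j, (A i j : ℂ) * x j := rfl
  rw [this, RCLike.inner_apply, Matrix.mulVec, Matrix.mulVec, dotProduct, dotProduct]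
  simp only [Complex.mul_re, Complex.conj_re, Complex.conj_im, Complex.re_sum, Complex.im_sum,
    Complex.ofReal_re, Complex.ofReal_im, Complex.mul_im, zero_mul, sub_zero, add_zero]
  ring

theorem re_inner_nonneg_of_posSemidef {A : Matrix (Fin n) (Fin n) ℝ} (hA : A.PosSemidef)
    (x : EuclideanSpace ℂ (Fin n)) :
    0 ≤ (inner ℂ x (Matrix.toEuclideanCLM (n := Fin n) (𝕜 := ℂ) (toComplex A) x)).re := by
  rw [re_inner_toComplex]
  have h1 := hA.dotProduct_mulVec_nonneg (fun i => (x i).re)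
  have h2 := hA.dotProduct_mulVec_nonneg (fun i => (x i).im)
  simp only [star_trivial] at h1 h2
  exact add_nonneg h1 h2

theorem re_inner_toComplex_sub_smul_one (A : Matrix (Fin n) (Fin n) ℝ) (c : ℝ)
    (x : EuclideanSpace ℂ (Fin n)) :
    (inner ℂ x (Matrix.toEuclideanCLM (n := Fin n) (𝕜 := ℂ) (toComplex (A - c • 1)) x)).re =
      (inner ℂ x (Matrix.toEuclideanCLM (n := Fin n) (𝕜 := ℂ) (toComplex A) x)).re -
        c * ‖x‖ ^ 2 := by
  have : toComplex (A - c • 1) = toComplex A - (c : ℂ) • 1 := by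
    ext i j
    by_cases h : i = j <;> simp [toComplex, h]
  rw [this, map_sub, map_smul, map_one, sub_apply, inner_sub_right,
    smul_apply, inner_smul_right, one_apply_eq_self,
    inner_self_eq_norm_sq_to_K, Complex.sub_re, Complex.re_ofReal_mul]
  norm_cast

theorem spectrum_finite_of_isSymm {A : Matrix (Fin n) (Fin n) ℝ} (hA : A.IsSymm) :
    (spectrum ℝ A).Finite := by
  have h : A.IsHermitian := hA
  rw [h.spectrum_real_eq_range_eigenvalues]
  exact Set.finite_range _

theorem spectrum_nonempty_of_isSymm (hn : 0 < n) {A : Matrix (Fin n) (Fin n) ℝ} (hA : A.IsSymm) :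
    (spectrum ℝ A).Nonempty := by
  have h : A.IsHermitian := hA
  have : Nonempty (Fin n) := ⟨⟨0, hn⟩⟩
  rw [h.spectrum_real_eq_range_eigenvalues]
  exact Set.range_nonempty _

theorem posSemidef_of_spectrum_nonneg {A : Matrix (Fin n) (Fin n) ℝ} (hA : A.IsSymm)
    (h : ∀ a ∈ spectrum ℝ A, 0 ≤ a) : A.PosSemidef := by
  have hH : A.IsHermitian := hA
  rw [hH.posSemidef_iff_eigenvalues_nonneg]
  intro i
  exact h _ (hH.spectrum_real_eq_range_eigenvalues ▸ Set.mem_range_self i)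

theorem lambdaMin_mul_le_re_inner {A : Matrix (Fin n) (Fin n) ℝ} (hA : A.IsSymm)
    (x : EuclideanSpace ℂ (Fin n)) : lambdaMin A * ‖x‖ ^ 2 ≤
      (inner ℂ x (Matrix.toEuclideanCLM (n := Fin n) (𝕜 := ℂ) (toComplex A) x)).re := by
  have hs : (A - lambdaMin A • 1).PosSemidef := by
    refine posSemidef_of_spectrum_nonneg (hA.sub (Matrix.isSymm_one.smul _)) fun a ha => ?_
    rw [← Algebra.algebraMap_eq_smul_one, ← spectrum.sub_singleton_eq] at ha
    obtain ⟨b, hb, c, rfl, rfl⟩ := ha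
    exact sub_nonneg.2 (csInf_le (spectrum_finite_of_isSymm hA).bddBelow hb)
  have := re_inner_nonneg_of_posSemidef hs x
  rw [re_inner_toComplex_sub_smul_one] at this
  linarith

theorem re_inner_le_lambdaMax_mul {A : Matrix (Fin n) (Fin n) ℝ} (hA : A.IsSymm)
    (x : EuclideanSpace ℂ (Fin n)) :
    (inner ℂ x (Matrix.toEuclideanCLM (n := Fin n) (𝕜 := ℂ) (toComplex A) x)).re ≤
      lambdaMax A * ‖x‖ ^ 2 := by
  have hs : (-A - (-lambdaMax A) • 1).PosSemidef := by
    refine posSemidef_of_spectrum_nonneg (hA.neg.sub (Matrix.isSymm_one.smul _)) fun a ha => ?_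
    rw [← Algebra.algebraMap_eq_smul_one, ← spectrum.sub_singleton_eq, ← spectrum.neg_eq] at ha
    obtain ⟨b, hb, c, rfl, rfl⟩ := ha
    have := le_csSup (spectrum_finite_of_isSymm hA).bddAbove (Set.mem_neg.1 hb)
    change 0 ≤ b - -lambdaMax A
    unfold lambdaMax
    linarith
  have := re_inner_nonneg_of_posSemidef hs x
  have hneg : toComplex (-A) = -toComplex A := by ext i j; simp [toComplex]
  rw [re_inner_toComplex_sub_smul_one, hneg, map_neg, neg_apply, inner_neg_right,
    Complex.neg_re] at this
  linarith

theorem lambdaMin_pos (hn : 0 < n) {A : Matrix (Fin n) (Fin n) ℝ} (hA : A.PosDef) :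
    0 < lambdaMin A := by
  have hs : A.IsSymm := hA.isHermitian
  have hmem := (spectrum_nonempty_of_isSymm hn hs).csInf_mem (spectrum_finite_of_isSymm hs)
  rw [hA.isHermitian.spectrum_real_eq_range_eigenvalues] at hmem
  obtain ⟨i, hi⟩ := hmem
  rw [lambdaMin, hA.isHermitian.spectrum_real_eq_range_eigenvalues, ← hi]
  exact hA.eigenvalues_pos i

theorem lambdaMin_le_lambdaMax (hn : 0 < n) {A : Matrix (Fin n) (Fin n) ℝ} (hA : A.IsSymm) :
    lambdaMin A ≤ lambdaMax A :=
  csInf_le_csSup (spectrum_nonempty_of_isSymm hn hA) (spectrum_finite_of_isSymm hA).bddBelow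
    (spectrum_finite_of_isSymm hA).bddAbove

/-- If `β` exceeds `-λ_min(B) / λ_max(A)` and `-λ_min(B) / λ_min(A)`, then `A s + B` has uniformly
positive definite Hermitian part on `Re s ≥ β`. -/
theorem exists_coercive (hn : 0 < n) {A B : Matrix (Fin n) (Fin n) ℝ} (hA : A.PosDef)
    (hB : B.IsSymm) {β : ℝ} (h₁ : -(lambdaMin B / lambdaMax A) < β)
    (h₂ : -(lambdaMin B / lambdaMin A) < β) :
    ∃ c : ℝ, 0 < c ∧ ∀ s : ℂ, β ≤ s.re → ∀ x : EuclideanSpace ℂ (Fin n),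
      c * ‖x‖ ^ 2 ≤ (inner ℂ x (Matrix.toEuclideanCLM (n := Fin n) (𝕜 := ℂ)
        (s • toComplex A + toComplex B) x)).re := by
  have hs : A.IsSymm := hA.isHermitian
  have hmin := lambdaMin_pos hn hA
  have hmax := hmin.trans_le (lambdaMin_le_lambdaMax hn hs)
  -- The smaller product is β·λ_min(A) for β ≥ 0 and β·λ_max(A) for β ≤ 0, which is why both
  -- quotients enter α.
  have hc : 0 < min (β * lambdaMin A) (β * lambdaMax A) + lambdaMin B := by
    rcases min_choice (β * lambdaMin A) (β * lambdaMax A) with h | h <;> rw [h]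
    · rw [← neg_div, div_lt_iff₀ hmin] at h₂; linarith
    · rw [← neg_div, div_lt_iff₀ hmax] at h₁; linarith
  refine ⟨_, hc, fun s hsβ x => ?_⟩
  have hA0 := re_inner_nonneg_of_posSemidef hA.posSemidef x
  have hA1 := lambdaMin_mul_le_re_inner hs x
  have hA2 := re_inner_le_lambdaMax_mul hs x
  have hB1 := lambdaMin_mul_le_re_inner hB x
  -- A real quadratic form ⟨x, Ax⟩ removes Im s from the real part, making the constant uniform in
  -- Im s.
  have him : (inner ℂ x (Matrix.toEuclideanCLM (n := Fin n) (𝕜 := ℂ) (toComplex A) x)).im = 0 := by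
    have hsa : IsSelfAdjoint (Matrix.toEuclideanCLM (n := Fin n) (𝕜 := ℂ) (toComplex A)) :=
      IsSelfAdjoint.map (show IsSelfAdjoint (toComplex A) from toComplex_isHermitian hs)
        (Matrix.toEuclideanCLM (n := Fin n) (𝕜 := ℂ))
    rw [← Complex.conj_eq_iff_im, inner_conj_symm]
    exact hsa.isSymmetric x x
  rw [map_add, map_smul, add_apply, smul_apply,
    inner_add_right, inner_smul_right, Complex.add_re, Complex.mul_re, him, mul_zero, sub_zero]
  have h3 := mul_le_mul_of_nonneg_right hsβ hA0
  have h4 : min (β * lambdaMin A) (β * lambdaMax A) * ‖x‖ ^ 2 ≤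
      β * (inner ℂ x (Matrix.toEuclideanCLM (n := Fin n) (𝕜 := ℂ) (toComplex A) x)).re := by
    rcases le_total 0 β with h0 | h0
    · calc _ ≤ β * lambdaMin A * ‖x‖ ^ 2 := by gcongr; exact min_le_left _ _
        _ ≤ _ := by rw [mul_assoc]; exact mul_le_mul_of_nonneg_left hA1 h0
    · calc _ ≤ β * lambdaMax A * ‖x‖ ^ 2 := by gcongr; exact min_le_right _ _
        _ ≤ _ := by rw [mul_assoc]; exact mul_le_mul_of_nonpos_left hA2 h0
  rw [add_mul]
  linarith

end Rayleigh

/-! ### The linear flow and its two components -/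

section Flow

variable {n : ℕ}

/-- The first half of a vector indexed by `Fin n ⊕ Fin n`. -/
noncomputable def fstBlock (n : ℕ) :
    EuclideanSpace ℂ (Fin n ⊕ Fin n) →L[ℂ] EuclideanSpace ℂ (Fin n) :=
  LinearMap.toContinuousLinearMap
    { toFun := fun w => WithLp.toLp 2 fun i => w (Sum.inl i)
      map_add' := fun _ _ => rfl
      map_smul' := fun _ _ => rfl }

/-- The second half of a vector indexed by `Fin n ⊕ Fin n`. -/
noncomputable def sndBlock (n : ℕ) :
    EuclideanSpace ℂ (Fin n ⊕ Fin n) →L[ℂ] EuclideanSpace ℂ (Fin n) :=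
  LinearMap.toContinuousLinearMap
    { toFun := fun w => WithLp.toLp 2 fun i => w (Sum.inr i)
      map_add' := fun _ _ => rfl
      map_smul' := fun _ _ => rfl }

theorem norm_sq_eq_add_blocks (w : EuclideanSpace ℂ (Fin n ⊕ Fin n)) :
    ‖w‖ ^ 2 = ‖fstBlock n w‖ ^ 2 + ‖sndBlock n w‖ ^ 2 := by
  rw [EuclideanSpace.norm_sq_eq, EuclideanSpace.norm_sq_eq, EuclideanSpace.norm_sq_eq,
    Fintype.sum_sum_type]
  rfl

theorem fstBlock_fromBlocks (A B C D : Matrix (Fin n) (Fin n) ℂ)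
    (w : EuclideanSpace ℂ (Fin n ⊕ Fin n)) :
    fstBlock n (Matrix.toEuclideanCLM (𝕜 := ℂ) (Matrix.fromBlocks A B C D) w) =
      Matrix.toEuclideanCLM (𝕜 := ℂ) A (fstBlock n w) +
      Matrix.toEuclideanCLM (𝕜 := ℂ) B (sndBlock n w) := by
  ext i
  exact congrFun (Matrix.fromBlocks_mulVec A B C D w.ofLp) (Sum.inl i)

theorem sndBlock_fromBlocks (A B C D : Matrix (Fin n) (Fin n) ℂ)
    (w : EuclideanSpace ℂ (Fin n ⊕ Fin n)) :
    sndBlock n (Matrix.toEuclideanCLM (𝕜 := ℂ) (Matrix.fromBlocks A B C D) w) =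
      Matrix.toEuclideanCLM (𝕜 := ℂ) C (fstBlock n w) +
      Matrix.toEuclideanCLM (𝕜 := ℂ) D (sndBlock n w) := by
  ext i
  exact congrFun (Matrix.fromBlocks_mulVec A B C D w.ofLp) (Sum.inr i)

theorem exists_blocks_eq (v j : EuclideanSpace ℂ (Fin n)) :
    ∃ w, fstBlock n w = v ∧ sndBlock n w = j :=
  ⟨WithLp.toLp 2 (Sum.elim v.ofLp j.ofLp), rfl, rfl⟩

theorem hasDerivAt_flow {m : Type*} [Fintype m] [DecidableEq m] (M : Matrix m m ℂ)
    (w : EuclideanSpace ℂ m) (x : ℝ) :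
    HasDerivAt (fun t : ℝ => Matrix.toEuclideanCLM (𝕜 := ℂ) (NormedSpace.exp ((t : ℂ) • M)) w)
      (Matrix.toEuclideanCLM (𝕜 := ℂ) M
        (Matrix.toEuclideanCLM (𝕜 := ℂ) (NormedSpace.exp ((x : ℂ) • M)) w)) x := by
  let T : Matrix m m ℂ →ₗ[ℝ] EuclideanSpace ℂ m :=
    { toFun := fun A => Matrix.toEuclideanCLM (𝕜 := ℂ) A w
      map_add' := fun A B => by simp
      map_smul' := fun r A => by
        rw [← Complex.coe_smul, map_smul, smul_apply, RingHom.id_apply, Complex.coe_smul] }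
  have h := hasDerivAt_exp_smul_const' (𝕂 := ℝ) M x
  have h2 := (LinearMap.toContinuousLinearMap T).hasFDerivAt.comp_hasDerivAt x h
  simp only [Complex.coe_smul]
  refine h2.congr_deriv ?_
  simp [T]

variable {P S : Matrix (Fin n) (Fin n) ℂ} (w : EuclideanSpace ℂ (Fin n ⊕ Fin n)) (x : ℝ)

theorem hasDerivAt_fstBlock_flow :
    HasDerivAt (fun t : ℝ => fstBlock n (Matrix.toEuclideanCLM (𝕜 := ℂ)
        (NormedSpace.exp ((t : ℂ) • Matrix.fromBlocks 0 P S 0)) w))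
      (Matrix.toEuclideanCLM (𝕜 := ℂ) P (sndBlock n (Matrix.toEuclideanCLM (𝕜 := ℂ)
        (NormedSpace.exp ((x : ℂ) • Matrix.fromBlocks 0 P S 0)) w))) x := by
  refine (((fstBlock n).restrictScalars ℝ).hasFDerivAt.comp_hasDerivAt x
    (hasDerivAt_flow (Matrix.fromBlocks 0 P S 0) w x)).congr_deriv ?_
  refine (fstBlock_fromBlocks _ _ _ _ _).trans ?_
  rw [map_zero, zero_apply, zero_add]

theorem hasDerivAt_sndBlock_flow :
    HasDerivAt (fun t : ℝ => sndBlock n (Matrix.toEuclideanCLM (𝕜 := ℂ)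
        (NormedSpace.exp ((t : ℂ) • Matrix.fromBlocks 0 P S 0)) w))
      (Matrix.toEuclideanCLM (𝕜 := ℂ) S (fstBlock n (Matrix.toEuclideanCLM (𝕜 := ℂ)
        (NormedSpace.exp ((x : ℂ) • Matrix.fromBlocks 0 P S 0)) w))) x := by
  refine (((sndBlock n).restrictScalars ℝ).hasFDerivAt.comp_hasDerivAt x
    (hasDerivAt_flow (Matrix.fromBlocks 0 P S 0) w x)).congr_deriv ?_
  refine (sndBlock_fromBlocks _ _ _ _ _).trans ?_
  rw [map_zero, zero_apply, add_zero]

theorem flow_zero {m : Type*} [Fintype m] [DecidableEq m] (M : Matrix m m ℂ)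
    (w : EuclideanSpace ℂ m) :
    Matrix.toEuclideanCLM (𝕜 := ℂ) (NormedSpace.exp (((0 : ℝ) : ℂ) • M)) w = w := by
  simp

theorem sndBlock_toEuclideanCLM (M : Matrix (Fin n ⊕ Fin n) (Fin n ⊕ Fin n) ℂ) :
    sndBlock n (Matrix.toEuclideanCLM (𝕜 := ℂ) M w) =
      Matrix.toEuclideanCLM (𝕜 := ℂ) M.toBlocks₂₁ (fstBlock n w) +
      Matrix.toEuclideanCLM (𝕜 := ℂ) M.toBlocks₂₂ (sndBlock n w) := by
  conv_lhs => rw [← Matrix.fromBlocks_toBlocks M]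
  exact sndBlock_fromBlocks _ _ _ _ _

end Flow

/-! ### The energy form of a pair of positive definite matrices -/

section EnergyMatrix

variable {n : ℕ} {A B : Matrix (Fin n) (Fin n) ℝ}

theorem inner_toComplex_symm (hA : A.IsSymm) (x y : EuclideanSpace ℂ (Fin n)) :
    inner ℂ (Matrix.toEuclideanCLM (n := Fin n) (𝕜 := ℂ) (toComplex A) x) y =
      inner ℂ x (Matrix.toEuclideanCLM (n := Fin n) (𝕜 := ℂ) (toComplex A) y) :=
  (IsSelfAdjoint.map (show IsSelfAdjoint (toComplex A) from toComplex_isHermitian hA)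
    (Matrix.toEuclideanCLM (n := Fin n) (𝕜 := ℂ))).isSymmetric x y

theorem exists_energy_bounds (hn : 0 < n) (hA : A.PosDef) (hB : B.PosDef) :
    ∃ e₁ e₂ : ℝ, 0 < e₁ ∧ 0 < e₂ ∧ ∀ v j : EuclideanSpace ℂ (Fin n),
      e₁ * (‖v‖ ^ 2 + ‖j‖ ^ 2) ≤
        (inner ℂ v (Matrix.toEuclideanCLM (n := Fin n) (𝕜 := ℂ) (toComplex A) v)).re +
        (inner ℂ j (Matrix.toEuclideanCLM (n := Fin n) (𝕜 := ℂ) (toComplex B) j)).re ∧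
      (inner ℂ v (Matrix.toEuclideanCLM (n := Fin n) (𝕜 := ℂ) (toComplex A) v)).re +
        (inner ℂ j (Matrix.toEuclideanCLM (n := Fin n) (𝕜 := ℂ) (toComplex B) j)).re ≤
        e₂ * (‖v‖ ^ 2 + ‖j‖ ^ 2) := by
  have hA0 := lambdaMin_pos hn hA
  have hB0 := lambdaMin_pos hn hB
  have hA1 := hA0.trans_le (lambdaMin_le_lambdaMax hn hA.isHermitian)
  refine ⟨min (lambdaMin A) (lambdaMin B), max (lambdaMax A) (lambdaMax B), lt_min hA0 hB0,
    lt_max_of_lt_left hA1, fun v j => ⟨?_, ?_⟩⟩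
  · rw [mul_add]
    exact add_le_add
      ((mul_le_mul_of_nonneg_right (min_le_left _ _) (sq_nonneg _)).trans
        (lambdaMin_mul_le_re_inner hA.isHermitian v))
      ((mul_le_mul_of_nonneg_right (min_le_right _ _) (sq_nonneg _)).trans
        (lambdaMin_mul_le_re_inner hB.isHermitian j))
  · rw [mul_add]
    exact add_le_add
      ((re_inner_le_lambdaMax_mul hA.isHermitian v).trans
        (mul_le_mul_of_nonneg_right (le_max_left _ _) (sq_nonneg _)))
      ((re_inner_le_lambdaMax_mul hB.isHermitian j).trans
        (mul_le_mul_of_nonneg_right (le_max_right _ _) (sq_nonneg _)))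

/-- Weighting the energy by L⁻¹ and C⁻¹ turns the coefficient of s into the identity, as
`hasDerivAt_energy` requires. -/
theorem toComplex_inv_mul_affine (hA : A.PosDef) (s : ℂ) (x : EuclideanSpace ℂ (Fin n)) :
    Matrix.toEuclideanCLM (n := Fin n) (𝕜 := ℂ) (toComplex A⁻¹)
      (Matrix.toEuclideanCLM (n := Fin n) (𝕜 := ℂ) (s • toComplex A + toComplex B) x) =
    s • x + Matrix.toEuclideanCLM (n := Fin n) (𝕜 := ℂ) (toComplex (A⁻¹ * B)) x := by
  have hdet := (Matrix.isUnit_iff_isUnit_det _).1 hA.isUnit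
  have h : toComplex A⁻¹ * (s • toComplex A + toComplex B) = s • 1 + toComplex (A⁻¹ * B) := by
    rw [mul_add, mul_smul_comm, ← toComplex_mul, ← toComplex_mul, Matrix.nonsing_inv_mul _ hdet,
      toComplex_one]
  rw [← mul_apply_eq_comp, ← map_mul, h, map_add, map_smul, map_one]
  rfl

end EnergyMatrix

/-! ### A priori bounds for the telegrapher's equations -/

namespace TransmissionLine

variable {n : ℕ} (ℓ : TransmissionLine n)

/-- The generator of the telegrapher's equations `V' = (L s + R) J`, `J' = (C s + G) V`. -/
noncomputable def generator (s : ℂ) : Matrix (Fin n ⊕ Fin n) (Fin n ⊕ Fin n) ℂ :=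
  Matrix.fromBlocks 0 (ℓ.series s) (ℓ.shunt s) 0

variable {ℓ}

/-- Without losses and with Re s = 0 the energy is conserved, and it is equivalent to the squared
norm with constants free of ω. This makes `kappa` a genuine supremum rather than the default value 0
of an unbounded `sSup`. -/
theorem bddAbove_losslessNorm (hn : 0 < n) (hL : ℓ.L.PosDef) (hC : ℓ.C.PosDef) :
    BddAbove (Set.range ℓ.losslessNorm) := by
  obtain ⟨e₁, e₂, he₁, he₂, hE⟩ := exists_energy_bounds hn hL.inv hC.inv
  have hLs : ℓ.L⁻¹.IsSymm := hL.inv.isHermitian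
  have hCs : ℓ.C⁻¹.IsSymm := hC.inv.isHermitian
  refine ⟨√(e₂ / e₁), ?_⟩
  rintro _ ⟨ω, rfl⟩
  rw [losslessNorm, Matrix.cstar_norm_def]
  refine ContinuousLinearMap.opNorm_le_bound _ (Real.sqrt_nonneg _) fun w => ?_
  set P := (Complex.I * ω) • toComplex ℓ.L with hP
  set S := (Complex.I * ω) • toComplex ℓ.C with hS
  have hA : ∀ x : EuclideanSpace ℂ (Fin n), Matrix.toEuclideanCLM (𝕜 := ℂ) (toComplex ℓ.L⁻¹)
      (Matrix.toEuclideanCLM (𝕜 := ℂ) P x) = (Complex.I * ω) • x +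
        (0 : EuclideanSpace ℂ (Fin n) →L[ℂ] EuclideanSpace ℂ (Fin n)) x := by
    intro x
    have := toComplex_inv_mul_affine (B := 0) hL (Complex.I * ω) x
    simpa [toComplex, hP] using this
  have hB : ∀ x : EuclideanSpace ℂ (Fin n), Matrix.toEuclideanCLM (𝕜 := ℂ) (toComplex ℓ.C⁻¹)
      (Matrix.toEuclideanCLM (𝕜 := ℂ) S x) = (Complex.I * ω) • x +
        (0 : EuclideanSpace ℂ (Fin n) →L[ℂ] EuclideanSpace ℂ (Fin n)) x := by
    intro x
    have := toComplex_inv_mul_affine (B := 0) hC (Complex.I * ω) x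
    simpa [toComplex, hS] using this
  have hd := hasDerivAt_energy (hasDerivAt_fstBlock_flow (P := P) (S := S) w)
    (hasDerivAt_sndBlock_flow w) (inner_toComplex_symm hLs)
    (inner_toComplex_symm hCs) hA hB
  have hconst := is_const_of_deriv_eq_zero (fun x => (hd x).differentiableAt)
    (fun x => by rw [(hd x).deriv]; simp) 1 0
  simp only [flow_zero, Complex.ofReal_one, one_smul] at hconst
  have h1 := (hE (fstBlock n (Matrix.toEuclideanCLM (𝕜 := ℂ)
    (NormedSpace.exp (Matrix.fromBlocks 0 P S 0)) w)) (sndBlock n (Matrix.toEuclideanCLM (𝕜 := ℂ)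
    (NormedSpace.exp (Matrix.fromBlocks 0 P S 0)) w))).1
  have h2 := (hE (fstBlock n w) (sndBlock n w)).2
  rw [hconst] at h1
  have h3 := h1.trans h2
  rw [← norm_sq_eq_add_blocks, ← norm_sq_eq_add_blocks] at h3
  refine abs_le_of_sq_le_sq' ?_ (by positivity) |>.2
  rw [mul_pow, Real.sq_sqrt (by positivity), div_mul_eq_mul_div, le_div_iff₀ he₁]
  linarith

theorem neg_div_lt_of_alpha_lt {β : ℝ} (h : ℓ.alpha < β) :
    (-(lambdaMin ℓ.G / lambdaMax ℓ.C) < β ∧ -(lambdaMin ℓ.G / lambdaMin ℓ.C) < β) ∧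
    (-(lambdaMin ℓ.R / lambdaMax ℓ.L) < β ∧ -(lambdaMin ℓ.R / lambdaMin ℓ.L) < β) := by
  rw [alpha, neg_lt, lt_min_iff, lt_min_iff, lt_min_iff] at h
  simpa only [neg_lt] using h

theorem exists_coercive_blocks (hn : 0 < n) (hL : ℓ.L.PosDef) (hC : ℓ.C.PosDef) (hR : ℓ.R.IsSymm)
    (hG : ℓ.G.IsSymm) {β : ℝ} (hβ : ℓ.alpha < β) :
    ∃ c : ℝ, 0 < c ∧ ∀ s : ℂ, β ≤ s.re → ∀ x : EuclideanSpace ℂ (Fin n),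
      c * ‖x‖ ^ 2 ≤ (inner ℂ x (Matrix.toEuclideanCLM (𝕜 := ℂ) (ℓ.series s) x)).re ∧
      c * ‖x‖ ^ 2 ≤ (inner ℂ x (Matrix.toEuclideanCLM (𝕜 := ℂ) (ℓ.shunt s) x)).re := by
  obtain ⟨⟨h1, h2⟩, h3, h4⟩ := neg_div_lt_of_alpha_lt hβ
  obtain ⟨c₁, hc₁, H₁⟩ := exists_coercive hn hL hR h3 h4
  obtain ⟨c₂, hc₂, H₂⟩ := exists_coercive hn hC hG h1 h2
  refine ⟨min c₁ c₂, lt_min hc₁ hc₂, fun s hs x => ⟨?_, ?_⟩⟩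
  · exact (mul_le_mul_of_nonneg_right (min_le_left _ _) (sq_nonneg _)).trans (H₁ s hs x)
  · exact (mul_le_mul_of_nonneg_right (min_le_right _ _) (sq_nonneg _)).trans (H₂ s hs x)

/-- On `Re s ≥ β > α` the voltage at one end of the line is bounded by the currents at both ends,
uniformly in `Im s`. -/
theorem exists_norm_fstBlock_le (hn : 0 < n) (hL : ℓ.L.PosDef) (hC : ℓ.C.PosDef)
    (hR : ℓ.R.IsSymm) (hG : ℓ.G.IsSymm) {β : ℝ} (hβ : ℓ.alpha < β) :
    ∃ a b c : ℝ, 0 ≤ a ∧ 0 ≤ b ∧ 0 ≤ c ∧ ∀ s : ℂ, β ≤ s.re → ∀ d : ℝ, 0 < d → ∀ w,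
      ‖fstBlock n w‖ ≤ (a / d + b * |s.re| + c) * (‖sndBlock n w‖ +
        ‖sndBlock n (Matrix.toEuclideanCLM (𝕜 := ℂ)
          (NormedSpace.exp ((d : ℂ) • ℓ.generator s)) w)‖) := by
  obtain ⟨k, hk, hcoer⟩ := exists_coercive_blocks hn hL hC hR hG hβ
  obtain ⟨e₁, e₂, he₁, he₂, hE⟩ := exists_energy_bounds hn hL.inv hC.inv
  have hLs : ℓ.L⁻¹.IsSymm := hL.inv.isHermitian
  have hCs : ℓ.C⁻¹.IsSymm := hC.inv.isHermitian
  set F := Matrix.toEuclideanCLM (n := Fin n) (𝕜 := ℂ) (toComplex (ℓ.L⁻¹ * ℓ.R))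
  set T := Matrix.toEuclideanCLM (n := Fin n) (𝕜 := ℂ) (toComplex (ℓ.C⁻¹ * ℓ.G))
  refine ⟨2 * e₂ / (k * e₁), 4 / (k * e₁), 2 * (‖F‖ + ‖T‖) / (k * e₁), by positivity,
    by positivity, by positivity, fun s hs d hd w => ?_⟩
  obtain ⟨V, hVdef⟩ : ∃ V : ℝ → EuclideanSpace ℂ (Fin n), V = fun t : ℝ => fstBlock n
    (Matrix.toEuclideanCLM (𝕜 := ℂ) (NormedSpace.exp ((t : ℂ) • ℓ.generator s)) w) := ⟨_, rfl⟩
  obtain ⟨J, hJdef⟩ : ∃ J : ℝ → EuclideanSpace ℂ (Fin n), J = fun t : ℝ => sndBlock n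
    (Matrix.toEuclideanCLM (𝕜 := ℂ) (NormedSpace.exp ((t : ℂ) • ℓ.generator s)) w) := ⟨_, rfl⟩
  have hV : ∀ x, HasDerivAt V (Matrix.toEuclideanCLM (𝕜 := ℂ) (ℓ.series s) (J x)) x := by
    rw [hVdef, hJdef]; exact hasDerivAt_fstBlock_flow w
  have hJ : ∀ x, HasDerivAt J (Matrix.toEuclideanCLM (𝕜 := ℂ) (ℓ.shunt s) (V x)) x := by
    rw [hVdef, hJdef]; exact hasDerivAt_sndBlock_flow w
  have hV0 : V 0 = fstBlock n w := by rw [hVdef]; exact congrArg _ (flow_zero _ w)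
  have hJ0 : J 0 = sndBlock n w := by rw [hJdef]; exact congrArg _ (flow_zero _ w)
  have hJd : J d = sndBlock n (Matrix.toEuclideanCLM (𝕜 := ℂ)
    (NormedSpace.exp ((d : ℂ) • ℓ.generator s)) w) := by rw [hJdef]
  rw [← hJd, ← hJ0, ← hV0]
  have hAP : ∀ x, Matrix.toEuclideanCLM (𝕜 := ℂ) (toComplex ℓ.L⁻¹)
      (Matrix.toEuclideanCLM (𝕜 := ℂ) (ℓ.series s) x) = s • x + F x :=
    toComplex_inv_mul_affine hL s
  have hBS : ∀ x, Matrix.toEuclideanCLM (𝕜 := ℂ) (toComplex ℓ.C⁻¹)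
      (Matrix.toEuclideanCLM (𝕜 := ℂ) (ℓ.shunt s) x) = s • x + T x :=
    toComplex_inv_mul_affine hC s
  have hD := hasDerivAt_energy hV hJ (inner_toComplex_symm hLs) (inner_toComplex_symm hCs) hAP hBS
  have hK : 0 ≤ 2 * |s.re| + ‖F‖ + ‖T‖ := by positivity
  obtain ⟨h0, h1⟩ := norm_sq_le_powerFlow hV hJ hk (fun x => (hcoer s hs x).1)
    (fun x => (hcoer s hs x).2) hD he₂ hK
    (fun x => abs_energy_deriv_le F T s.re _ _) (fun x => (hE _ _).1) (fun x => (hE _ _).2) he₁ hd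
  have hm : 0 < k * e₁ / (e₂ / d + (2 * |s.re| + ‖F‖ + ‖T‖)) := by positivity
  have := norm_le_of_powerFlow hm h0 h1
  refine this.trans_eq ?_
  congr 1
  field_simp
  ring

end TransmissionLine

/-! ### Inverting the admittance matrix -/

section MatrixLemmas

variable {n : ℕ}

theorem Matrix.isUnit_of_toEuclideanCLM_injective {A : Matrix (Fin n) (Fin n) ℂ}
    (h : ∀ x, Matrix.toEuclideanCLM (𝕜 := ℂ) A x = 0 → x = 0) : IsUnit A := by
  rw [Matrix.isUnit_iff_isUnit_det, isUnit_iff_ne_zero]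
  intro h0
  obtain ⟨v, hv, hAv⟩ := Matrix.exists_mulVec_eq_zero_iff.2 h0
  refine hv (congrArg WithLp.ofLp (h (WithLp.toLp 2 v) ?_))
  rw [Matrix.toEuclideanCLM_toLp, hAv]
  rfl

theorem isUnit_of_coercive {A : Matrix (Fin n) (Fin n) ℂ} {c : ℝ} (hc : 0 < c)
    (h : ∀ x, c * ‖x‖ ^ 2 ≤ (inner ℂ x (Matrix.toEuclideanCLM (𝕜 := ℂ) A x)).re) : IsUnit A := by
  refine Matrix.isUnit_of_toEuclideanCLM_injective fun x hx => ?_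
  have := h x
  rw [hx, inner_zero_right, Complex.zero_re] at this
  have h2 : ‖x‖ ^ 2 ≤ 0 := nonpos_of_mul_nonpos_right this hc
  exact norm_eq_zero.1 (pow_eq_zero_iff two_ne_zero |>.1 (le_antisymm h2 (sq_nonneg _)))

/-- If SPx = μx with μ ≤ 0 and y = S⁻¹x, then Px = μy and Re⟨x, Px⟩ = μ Re⟨y, Sy⟩ ≤ 0, so coercivity
of P forces x = 0. -/
theorem spectrum_mul_subset_slitPlane {P S : Matrix (Fin n) (Fin n) ℂ} {c : ℝ} (hc : 0 < c)
    (hP : ∀ x, c * ‖x‖ ^ 2 ≤ (inner ℂ x (Matrix.toEuclideanCLM (𝕜 := ℂ) P x)).re)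
    (hS : ∀ x, c * ‖x‖ ^ 2 ≤ (inner ℂ x (Matrix.toEuclideanCLM (𝕜 := ℂ) S x)).re) :
    spectrum ℂ (S * P) ⊆ Complex.slitPlane := by
  intro μ hμ
  by_contra hslit
  rw [Complex.mem_slitPlane_iff, not_or, not_lt, not_not] at hslit
  have hSdet := (Matrix.isUnit_iff_isUnit_det _).1 (isUnit_of_coercive hc hS)
  refine hμ (Matrix.isUnit_of_toEuclideanCLM_injective fun x hx => ?_)
  rw [Algebra.algebraMap_eq_smul_one, map_sub, map_smul, map_one, sub_apply, smul_apply,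
    one_apply_eq_self, sub_eq_zero] at hx
  set y := Matrix.toEuclideanCLM (𝕜 := ℂ) S⁻¹ x with hy
  have hSy : Matrix.toEuclideanCLM (𝕜 := ℂ) S y = x := by
    rw [hy, ← mul_apply_eq_comp, ← map_mul, Matrix.mul_nonsing_inv _ hSdet, map_one]; rfl
  have hPx : Matrix.toEuclideanCLM (𝕜 := ℂ) P x = μ • y := by
    rw [hy, ← map_smul, hx, ← mul_apply_eq_comp, ← map_mul,
      Matrix.nonsing_inv_mul_cancel_left _ _ hSdet]
  have h1 := hP x
  have h2 := hS y
  have h3 : (inner ℂ x y).re = (inner ℂ y (Matrix.toEuclideanCLM (𝕜 := ℂ) S y)).re := by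
    rw [hSy]; exact inner_re_symm (𝕜 := ℂ) _ _
  rw [hPx, inner_smul_right, Complex.mul_re, hslit.2, zero_mul, sub_zero, h3] at h1
  have h4 : 0 ≤ (inner ℂ y (Matrix.toEuclideanCLM (𝕜 := ℂ) S y)).re := le_trans (by positivity) h2
  have h5 := mul_nonpos_of_nonpos_of_nonneg hslit.1 h4
  have h6 : ‖x‖ ^ 2 ≤ 0 := nonpos_of_mul_nonpos_right (h1.trans h5) hc
  exact norm_eq_zero.1 (pow_eq_zero_iff two_ne_zero |>.1 (le_antisymm h6 (sq_nonneg _)))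

/-- W = B⁻¹Γ⁻¹ = (sh²)⁻¹ commutes with D, so the diagonal blocks are (D² - 1)W = 1 and the
off-diagonal ones are commutators of D and W. -/
theorem admittance_mul_impedance {B Γ D sh : Matrix (Fin n) (Fin n) ℂ} (hsh : IsUnit sh)
    (hΓB : Γ * B = sh * sh) (hD : D * D - 1 = sh * sh) (hcomm : Commute D sh) :
    Matrix.fromBlocks (D * B⁻¹) (-B⁻¹) (-B⁻¹) (D * B⁻¹) *
      Matrix.fromBlocks (Γ⁻¹ * D) Γ⁻¹ Γ⁻¹ (Γ⁻¹ * D) = 1 := by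
  have hdet := (Matrix.isUnit_iff_isUnit_det _).1 (hsh.mul hsh)
  have hW : B⁻¹ * Γ⁻¹ = (sh * sh)⁻¹ := by rw [← hΓB, Matrix.mul_inv_rev]
  have hDW : D * (sh * sh)⁻¹ = (sh * sh)⁻¹ * D := by
    have h := (hcomm.mul_right hcomm).eq
    calc D * (sh * sh)⁻¹ = (sh * sh)⁻¹ * ((sh * sh) * D) * (sh * sh)⁻¹ := by
          rw [Matrix.nonsing_inv_mul_cancel_left _ _ hdet]
      _ = (sh * sh)⁻¹ * D := by
          rw [← h, ← mul_assoc, Matrix.mul_nonsing_inv_cancel_right _ _ hdet]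
  have hdiag : D * (sh * sh)⁻¹ * D - (sh * sh)⁻¹ = 1 := by
    rw [mul_assoc, ← hDW, ← mul_assoc, ← sub_one_mul, hD, Matrix.mul_nonsing_inv _ hdet]
  have hBΓ (X : Matrix (Fin n) (Fin n) ℂ) : B⁻¹ * (Γ⁻¹ * X) = (sh * sh)⁻¹ * X := by
    rw [← mul_assoc, hW]
  rw [Matrix.fromBlocks_multiply, ← Matrix.fromBlocks_one, Matrix.fromBlocks_inj]
  simp only [mul_assoc, neg_mul, hBΓ, hW]
  rw [← mul_assoc, ← sub_eq_add_neg, hdiag, ← sub_eq_add_neg, hDW, sub_self, neg_add_cancel,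
    neg_add_eq_sub, ← hDW, hdiag]
  exact ⟨rfl, rfl, rfl, rfl⟩

/-- The linear map `(A, B) ↦ [[A, B], [B, A]]`. -/
noncomputable def symmetricBlocks (n : ℕ) :
    Matrix (Fin n) (Fin n) ℂ × Matrix (Fin n) (Fin n) ℂ →L[ℂ]
      Matrix (Fin n ⊕ Fin n) (Fin n ⊕ Fin n) ℂ :=
  LinearMap.toContinuousLinearMap
    { toFun := fun X => Matrix.fromBlocks X.1 X.2 X.2 X.1
      map_add' := fun X Y => by simp [Matrix.fromBlocks_add]
      map_smul' := fun c X => by simp [Matrix.fromBlocks_smul] }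

/-- The lower left block, as a continuous linear map. -/
noncomputable def lowerLeftBlock (n : ℕ) :
    Matrix (Fin n ⊕ Fin n) (Fin n ⊕ Fin n) ℂ →L[ℂ] Matrix (Fin n) (Fin n) ℂ :=
  LinearMap.toContinuousLinearMap
    { toFun := fun X => X.toBlocks₂₁
      map_add' := fun _ _ => rfl
      map_smul' := fun _ _ => rfl }

/-- The lower right block, as a continuous linear map. -/
noncomputable def lowerRightBlock (n : ℕ) :
    Matrix (Fin n ⊕ Fin n) (Fin n ⊕ Fin n) ℂ →L[ℂ] Matrix (Fin n) (Fin n) ℂ :=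
  LinearMap.toContinuousLinearMap
    { toFun := fun X => X.toBlocks₂₂
      map_add' := fun _ _ => rfl
      map_smul' := fun _ _ => rfl }

/-- The impedance matrix of a reciprocal symmetric two-port with chain matrix `X`. -/
noncomputable def impedanceOfChain (X : Matrix (Fin n ⊕ Fin n) (Fin n ⊕ Fin n) ℂ) :
    Matrix (Fin n ⊕ Fin n) (Fin n ⊕ Fin n) ℂ :=
  symmetricBlocks n ((lowerLeftBlock n X)⁻¹ * lowerRightBlock n X, (lowerLeftBlock n X)⁻¹)

theorem analyticAt_impedanceOfChain {X : Matrix (Fin n ⊕ Fin n) (Fin n ⊕ Fin n) ℂ}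
    (hX : IsUnit (lowerLeftBlock n X)) : AnalyticAt ℂ impedanceOfChain X := by
  have hinv : AnalyticAt ℂ (fun X => (lowerLeftBlock n X)⁻¹) X := by
    simp only [Matrix.nonsing_inv_eq_ringInverse]
    obtain ⟨u, hu⟩ := hX
    exact (hu ▸ analyticAt_inverse (𝕜 := ℂ) u : AnalyticAt ℂ Ring.inverse (lowerLeftBlock n X)).comp
      ((lowerLeftBlock n).analyticAt X)
  exact ((symmetricBlocks n).analyticAt _).comp
    ((hinv.mul ((lowerRightBlock n).analyticAt X)).prod hinv)

end MatrixLemmas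

/-! ### Well-definedness, regularity and growth of the impedance matrix -/

namespace TransmissionLine

variable {n : ℕ} {ℓ : TransmissionLine n}

/-- A kernel vector is an initial voltage which, with J(0) = 0, also gives J(d) = 0; the a priori
bound makes it vanish. -/
theorem isUnit_lowerLeftBlock (hn : 0 < n) (hL : ℓ.L.PosDef) (hC : ℓ.C.PosDef)
    (hR : ℓ.R.IsSymm) (hG : ℓ.G.IsSymm) {s : ℂ} (hs : s ∈ rightHalfPlane ℓ.alpha) {d : ℝ}
    (hd : 0 < d) :
    IsUnit (lowerLeftBlock n (NormedSpace.exp ((d : ℂ) • ℓ.generator s))) := by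
  obtain ⟨a, b, c, -, -, -, H⟩ := exists_norm_fstBlock_le hn hL hC hR hG hs
  refine Matrix.isUnit_of_toEuclideanCLM_injective fun v hv => ?_
  obtain ⟨w, hw₁, hw₂⟩ := exists_blocks_eq v 0
  have h := H s le_rfl d hd w
  change Matrix.toEuclideanCLM (𝕜 := ℂ) (Matrix.toBlocks₂₁ _) v = 0 at hv
  rw [sndBlock_toEuclideanCLM, hw₁, hw₂, hv, map_zero, norm_zero, add_zero, norm_zero, add_zero,
    mul_zero] at h
  exact norm_le_zero_iff.1 h

theorem existsUnique_root (hn : 0 < n) (hL : ℓ.L.PosDef) (hC : ℓ.C.PosDef)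
    (hR : ℓ.R.IsSymm) (hG : ℓ.G.IsSymm) {s : ℂ} (hs : s ∈ rightHalfPlane ℓ.alpha) :
    ∃! X, IsPrincipalSqrt (ℓ.shunt s * ℓ.series s) X := by
  obtain ⟨c, hc, H⟩ := exists_coercive_blocks hn hL hC hR hG hs
  exact existsUnique_isPrincipalSqrt _ (spectrum_mul_subset_slitPlane hc
    (fun x => (H s le_rfl x).1) (fun x => (H s le_rfl x).2))

theorem isUnit_root (hn : 0 < n) (hL : ℓ.L.PosDef) (hC : ℓ.C.PosDef)
    (hR : ℓ.R.IsSymm) (hG : ℓ.G.IsSymm) {s : ℂ} (hs : s ∈ rightHalfPlane ℓ.alpha) :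
    IsUnit (ℓ.root s) :=
  (isPrincipalSqrt_principalSqrt (existsUnique_root hn hL hC hR hG hs)).isUnit

theorem admittance_wellDefined (hn : 0 < n) (hL : ℓ.L.PosDef) (hC : ℓ.C.PosDef)
    (hR : ℓ.R.IsSymm) (hG : ℓ.G.IsSymm) {s : ℂ} (hs : s ∈ rightHalfPlane ℓ.alpha) {d : ℝ}
    (hd : 0 < d) :
    IsUnit (ℓ.blockB d s) ∧ IsUnit (ℓ.admittance s d) ∧
      ℓ.impedance s d = impedanceOfChain (NormedSpace.exp ((d : ℂ) • ℓ.generator s)) := by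
  obtain ⟨c, hc, H⟩ := exists_coercive_blocks hn hL hC hR hG hs
  have hP : IsUnit (ℓ.series s) := isUnit_of_coercive hc fun x => (H s le_rfl x).1
  have hQ := isUnit_root hn hL hC hR hG hs
  have hQdet := (Matrix.isUnit_iff_isUnit_det _).1 hQ
  have hsq : ℓ.root s ^ 2 = ℓ.shunt s * ℓ.series s :=
    (isPrincipalSqrt_principalSqrt (existsUnique_root hn hL hC hR hG hs)).2
  obtain ⟨hΓ, hD⟩ := exp_fromBlocks_antidiagonal hQ hsq d
  have hΓu := isUnit_lowerLeftBlock hn hL hC hR hG hs hd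
  change lowerLeftBlock n (NormedSpace.exp ((d : ℂ) • ℓ.generator s)) = _ at hΓ
  change lowerRightBlock n (NormedSpace.exp ((d : ℂ) • ℓ.generator s)) = ℓ.blockD d s at hD
  -- Invertibility of sinh(dQ) is read off from that of Γ = sinh(dQ)Q⁻¹S, not from the spectrum of
  -- Q.
  have hsh : IsUnit (matrixSinh ((d : ℂ) • ℓ.root s)) := by
    rw [hΓ, Matrix.isUnit_iff_isUnit_det, Matrix.det_mul, Matrix.det_mul] at hΓu
    rw [Matrix.isUnit_iff_isUnit_det]
    exact isUnit_of_mul_isUnit_left (isUnit_of_mul_isUnit_left hΓu)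
  have hQinv : IsUnit (ℓ.root s)⁻¹ := Matrix.isUnit_nonsing_inv_iff.2 hQ
  have hΓB : lowerLeftBlock n (NormedSpace.exp ((d : ℂ) • ℓ.generator s)) * ℓ.blockB d s =
      matrixSinh ((d : ℂ) • ℓ.root s) * matrixSinh ((d : ℂ) • ℓ.root s) := by
    rw [hΓ, blockB, charImpedance]
    calc _ = matrixSinh ((d : ℂ) • ℓ.root s) * ((ℓ.root s)⁻¹ *
          ((ℓ.shunt s * ℓ.series s) * ((ℓ.root s)⁻¹ * matrixSinh ((d : ℂ) • ℓ.root s)))) := by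
          simp only [mul_assoc]
      _ = _ := by
          rw [← hsq, sq, mul_assoc, Matrix.mul_nonsing_inv_cancel_left _ _ hQdet,
            Matrix.nonsing_inv_mul_cancel_left _ _ hQdet]
  have hYZ := admittance_mul_impedance hsh hΓB (matrixCosh_mul_self_sub_one _)
    (commute_matrixCosh_matrixSinh _)
  refine ⟨(hP.mul hQinv).mul hsh, IsUnit.of_mul_eq_one _ hYZ, ?_⟩
  rw [impedance, impedanceOfChain, hD]
  exact Matrix.inv_eq_right_inv hYZ

theorem generator_eq (s : ℂ) : ℓ.generator s =
    s • Matrix.fromBlocks 0 (toComplex ℓ.L) (toComplex ℓ.C) 0 +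
      Matrix.fromBlocks 0 (toComplex ℓ.R) (toComplex ℓ.G) 0 := by
  simp [generator, series, shunt, Matrix.fromBlocks_smul, Matrix.fromBlocks_add]

theorem analyticAt_impedance (hn : 0 < n) (hL : ℓ.L.PosDef) (hC : ℓ.C.PosDef)
    (hR : ℓ.R.IsSymm) (hG : ℓ.G.IsSymm) {s : ℂ} (hs : s ∈ rightHalfPlane ℓ.alpha) {d : ℝ}
    (hd : 0 < d) : AnalyticAt ℂ (fun s => ℓ.impedance s d) s := by
  have hopen : IsOpen (rightHalfPlane ℓ.alpha) := isOpen_lt continuous_const Complex.continuous_re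
  have hg : AnalyticAt ℂ (fun s => (d : ℂ) • ℓ.generator s) s := by
    simp only [generator_eq]
    fun_prop
  have h : AnalyticAt ℂ
      (fun s => impedanceOfChain (NormedSpace.exp ((d : ℂ) • ℓ.generator s))) s :=
    (analyticAt_impedanceOfChain (isUnit_lowerLeftBlock hn hL hC hR hG hs hd)).comp
      (f := fun s => NormedSpace.exp ((d : ℂ) • ℓ.generator s))
      ((NormedSpace.exp_analytic (𝕂 := ℂ) ((d : ℂ) • ℓ.generator s)).comp
        (f := fun s => (d : ℂ) • ℓ.generator s) hg)
  refine h.congr ?_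
  -- The formula through the chain matrix is available only on the half-plane; openness suffices.
  filter_upwards [hopen.mem_nhds hs] with t ht
  exact (admittance_wellDefined hn hL hC hR hG ht hd).2.2.symm

theorem continuousOn_impedance (hn : 0 < n) (hL : ℓ.L.PosDef) (hC : ℓ.C.PosDef)
    (hR : ℓ.R.IsSymm) (hG : ℓ.G.IsSymm) :
    ContinuousOn (fun p : ℂ × ℝ => ℓ.impedance p.1 p.2)
      (rightHalfPlane ℓ.alpha ×ˢ Set.Ioi (0 : ℝ)) := by
  have hg : Continuous fun p : ℂ × ℝ => NormedSpace.exp ((p.2 : ℂ) • ℓ.generator p.1) := by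
    simp only [generator_eq]
    have hexp : Continuous (NormedSpace.exp : Matrix (Fin n ⊕ Fin n) (Fin n ⊕ Fin n) ℂ → _) :=
      continuous_iff_continuousAt.2 fun X => (NormedSpace.exp_analytic (𝕂 := ℂ) X).continuousAt
    exact hexp.comp ((Complex.continuous_ofReal.comp continuous_snd).smul
      ((continuous_fst.smul continuous_const).add continuous_const))
  have h : ContinuousOn (fun p : ℂ × ℝ =>
      impedanceOfChain (NormedSpace.exp ((p.2 : ℂ) • ℓ.generator p.1)))
      (rightHalfPlane ℓ.alpha ×ˢ Set.Ioi (0 : ℝ)) := fun p hp =>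
    ((analyticAt_impedanceOfChain
      (isUnit_lowerLeftBlock hn hL hC hR hG hp.1 hp.2)).continuousAt.comp
      (f := fun p : ℂ × ℝ => NormedSpace.exp ((p.2 : ℂ) • ℓ.generator p.1))
      hg.continuousAt).continuousWithinAt
  exact h.congr fun p hp => (admittance_wellDefined hn hL hC hR hG hp.1 hp.2).2.2

theorem exists_norm_impedance_le (hn : 0 < n) (hL : ℓ.L.PosDef) (hC : ℓ.C.PosDef)
    (hR : ℓ.R.IsSymm) (hG : ℓ.G.IsSymm) {β : ℝ} (hβ : ℓ.alpha < β) {δ : ℝ} (hδ : 0 < δ) :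
    ∃ a b : ℝ, 0 ≤ a ∧ 0 ≤ b ∧ ∀ s : ℂ, β ≤ s.re → ∀ d : ℝ, δ ≤ d →
      ‖ℓ.impedance s d‖ ≤ a + b * |s.re| := by
  obtain ⟨a, b, c, ha, hb, hc, H⟩ := exists_norm_fstBlock_le hn hL hC hR hG hβ
  refine ⟨‖symmetricBlocks n‖ * (a / δ + c), ‖symmetricBlocks n‖ * b, by positivity, by positivity,
    fun s hs d hd => ?_⟩
  have hd0 := hδ.trans_le hd
  have hsα : s ∈ rightHalfPlane ℓ.alpha := hβ.trans_le hs
  have hΓu := isUnit_lowerLeftBlock hn hL hC hR hG hsα hd0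
  have hΓdet := (Matrix.isUnit_iff_isUnit_det _).1 hΓu
  rw [(admittance_wellDefined hn hL hC hR hG hsα hd0).2.2, impedanceOfChain]
  have hH := H s hs d hd0
  simp only [sndBlock_toEuclideanCLM] at hH
  generalize NormedSpace.exp ((d : ℂ) • ℓ.generator s) = X at hΓdet hH
  change IsUnit (Matrix.det X.toBlocks₂₁) at hΓdet
  change ‖symmetricBlocks n (X.toBlocks₂₁⁻¹ * X.toBlocks₂₂, X.toBlocks₂₁⁻¹)‖ ≤ _
  have hcancel : ∀ v, Matrix.toEuclideanCLM (𝕜 := ℂ) X.toBlocks₂₁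
      (Matrix.toEuclideanCLM (𝕜 := ℂ) X.toBlocks₂₁⁻¹ v) = v := by
    intro v
    rw [← mul_apply_eq_comp, ← map_mul, Matrix.mul_nonsing_inv _ hΓdet, map_one]; rfl
  have hK : a / d + b * |s.re| + c ≤ a / δ + b * |s.re| + c := by gcongr
  have h₁ : ‖X.toBlocks₂₁⁻¹‖ ≤ a / δ + b * |s.re| + c := by
    rw [Matrix.cstar_norm_def]
    refine ContinuousLinearMap.opNorm_le_bound _ (by positivity) fun j => ?_
    -- Boundary currents J(0) = 0 and J(d) = j, for which V(0) = Γ⁻¹j.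
    obtain ⟨w, hw₁, hw₂⟩ := exists_blocks_eq (Matrix.toEuclideanCLM (𝕜 := ℂ) X.toBlocks₂₁⁻¹ j) 0
    have h := hH w
    rw [hw₁, hw₂, hcancel, map_zero, add_zero, norm_zero, zero_add] at h
    exact h.trans (mul_le_mul_of_nonneg_right hK (norm_nonneg _))
  have h₂ : ‖X.toBlocks₂₁⁻¹ * X.toBlocks₂₂‖ ≤ a / δ + b * |s.re| + c := by
    rw [Matrix.cstar_norm_def]
    refine ContinuousLinearMap.opNorm_le_bound _ (by positivity) fun j => ?_
    rw [map_mul, mul_apply_eq_comp]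
    -- Boundary currents J(0) = -j and J(d) = 0, for which V(0) = Γ⁻¹Dj.
    obtain ⟨w, hw₁, hw₂⟩ := exists_blocks_eq (Matrix.toEuclideanCLM (𝕜 := ℂ) X.toBlocks₂₁⁻¹
      (Matrix.toEuclideanCLM (𝕜 := ℂ) X.toBlocks₂₂ j)) (-j)
    have h := hH w
    rw [hw₁, hw₂, hcancel, map_neg, add_neg_cancel, norm_zero, add_zero, norm_neg] at h
    exact h.trans (mul_le_mul_of_nonneg_right hK (norm_nonneg _))
  calc _ ≤ ‖symmetricBlocks n‖ * ‖(X.toBlocks₂₁⁻¹ * X.toBlocks₂₂, X.toBlocks₂₁⁻¹)‖ :=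
        ContinuousLinearMap.le_opNorm _ _
    _ ≤ ‖symmetricBlocks n‖ * (a / δ + b * |s.re| + c) := by
        gcongr
        exact max_le h₂ h₁
    _ = _ := by ring

theorem nu_pos (hn : 0 < n) (hL : ℓ.L.PosDef) (hC : ℓ.C.PosDef) : 0 < ℓ.nu := by
  have : Nonempty (Fin n) := ⟨⟨0, hn⟩⟩
  have hκ : 0 < ℓ.kappa := by
    refine lt_of_lt_of_le ?_ (le_csSup (bddAbove_losslessNorm hn hL hC) ⟨0, rfl⟩)
    simp [losslessNorm]
  have hLpos : 0 < ‖toComplex ℓ.L‖ := by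
    rw [norm_pos_iff]
    intro h0
    have h := toComplex_mul ℓ.L⁻¹ ℓ.L
    rw [h0, mul_zero, Matrix.nonsing_inv_mul _ ((Matrix.isUnit_iff_isUnit_det _).1 hL.isUnit),
      toComplex_one] at h
    exact one_ne_zero h
  have := lt_max_of_lt_left (c := ‖toComplex ℓ.C‖) hLpos
  rw [nu]
  positivity

theorem theta_nonneg : 0 ≤ ℓ.theta := by
  rw [theta]
  exact div_nonneg (le_max_of_le_left (norm_nonneg _)) (le_max_of_le_left (norm_nonneg _))

theorem exists_norm_impedance_le_exp (hn : 0 < n) (hL : ℓ.L.PosDef) (hC : ℓ.C.PosDef)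
    (hR : ℓ.R.IsSymm) (hG : ℓ.G.IsSymm) {β : ℝ} (hβ₀ : 0 ≤ β) (hβ : ℓ.alpha < β) {δ : ℝ}
    (hδ : 0 < δ) :
    ∃ M : ℝ, 0 < M ∧ ∀ s : ℂ, β ≤ s.re → ∀ d : ℝ, δ ≤ d →
      ‖ℓ.impedance s d‖ ≤ M * Real.exp (n * d / ℓ.nu * (s + ℓ.theta).re) := by
  obtain ⟨a, b, ha, hb, H⟩ := exists_norm_impedance_le hn hL hC hR hG hβ hδ
  have hν := nu_pos hn hL hC
  have hθ := theta_nonneg (ℓ := ℓ)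
  have hn' : (0 : ℝ) < n := Nat.cast_pos.2 hn
  -- The smallest exponential rate over d ≥ δ. Only its positivity and θ ≥ 0 matter: 1 + τ Re s ≤
  -- exp(τ Re s) already dominates the affine bound.
  set τ := n * δ / ℓ.nu with hτ
  have hτ0 : 0 < τ := by positivity
  refine ⟨a + b / τ + 1, by positivity, fun s hs d hd => (H s hs d hd).trans ?_⟩
  have hσ : 0 ≤ s.re := hβ₀.trans hs
  have h1 : τ * s.re ≤ n * d / ℓ.nu * (s + ℓ.theta).re := by
    rw [Complex.add_re, Complex.ofReal_re, hτ]
    refine mul_le_mul (by gcongr) (by linarith) hσ ?_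
    have := hδ.trans_le hd
    positivity
  have h2 := (add_le_add_left h1 1).trans (Real.add_one_le_exp _)
  rw [abs_of_nonneg hσ]
  calc a + b * s.re ≤ (a + b / τ + 1) * (τ * s.re + 1) := by
        have h3 : b / τ * (τ * s.re) = b * s.re := by field_simp
        have h4 : 0 ≤ a * (τ * s.re) := by positivity
        have h5 : 0 ≤ b / τ := by positivity
        have h6 : 0 ≤ τ * s.re := by positivity
        nlinarith
    _ ≤ _ := by gcongr

end TransmissionLine

theorem theorem4 (n : ℕ) (hn : 0 < n) (ℓ : TransmissionLine n)
    (hL : ℓ.L.PosDef) (hC : ℓ.C.PosDef) (hR : ℓ.R.IsSymm) (hG : ℓ.G.IsSymm) :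
    -- the objects in the statement are well defined
    (∀ s ∈ rightHalfPlane ℓ.alpha,
      (∃! X, IsPrincipalSqrt (ℓ.shunt s * ℓ.series s) X) ∧ IsUnit (ℓ.root s) ∧
      ∀ d : ℝ, 0 < d → IsUnit (ℓ.blockB d s) ∧ IsUnit (ℓ.admittance s d)) ∧
    BddAbove (Set.range ℓ.losslessNorm) ∧
    -- joint continuity
    ContinuousOn (fun p : ℂ × ℝ => ℓ.impedance p.1 p.2)
      (rightHalfPlane ℓ.alpha ×ˢ Set.Ioi (0 : ℝ)) ∧
    -- analyticity in `s`
    (∀ d : ℝ, 0 < d → AnalyticOnNhd ℂ (fun s => ℓ.impedance s d) (rightHalfPlane ℓ.alpha)) ∧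
    -- growth bound
    (∀ β : ℝ, 0 ≤ β → ℓ.alpha < β → ∀ δ : ℝ, 0 < δ → ∃ M : ℝ, 0 < M ∧
      ∀ s : ℂ, β ≤ s.re → ∀ d : ℝ, δ ≤ d →
        ‖ℓ.impedance s d‖ ≤ M * Real.exp (n * d / ℓ.nu * (s + ℓ.theta).re)) := by
  refine ⟨fun s hs => ⟨ℓ.existsUnique_root hn hL hC hR hG hs, ℓ.isUnit_root hn hL hC hR hG hs,
    fun d hd => ?_⟩, ℓ.bddAbove_losslessNorm hn hL hC, ℓ.continuousOn_impedance hn hL hC hR hG,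
    fun d hd s hs => ℓ.analyticAt_impedance hn hL hC hR hG hs hd,
    fun β hβ₀ hβ δ hδ => ℓ.exists_norm_impedance_le_exp hn hL hC hR hG hβ₀ hβ hδ⟩
  obtain ⟨hB, hY, -⟩ := ℓ.admittance_wellDefined hn hL hC hR hG hs hd
  exact ⟨hB, hY⟩
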